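/- Let $d\in\{1,2,3\}$, let $\mathscr O\subset\mathbb R^d$ be a nonempty bounded open set, $H:=L^2(\mathscr O)$ with norm $\|\cdot\|$, $\dot H^1:=H^1_0(\mathscr O)$ with dual $\dot H^{-1}$, let $A$ be the Dirichlet Laplacian on $\mathscr O$ and $\lambda_1$ the first eigenvalue of $-A$. Let $Q$ be a positive definite, self-adjoint, trace class operator on $H$ with orthonormal basis of eigenvectors $(g_k)_{k\in\mathbb N}$ and eigenvalues $q_k>0$, $\sum_k q_k<\infty$. Put $H_0:=Q^{1/2}H$ with norm $\|Q^{-1/2}\cdot\|$, and let $\mathcal L_2^0$ be the space of Hilbert–Schmidt operators from $H_0$ to $H$, so that $\|T\|_{\mathcal L_2^0}^2=\sum_k q_k\|Tg_k\|^2$. Let $W$ be an $H$-valued $Q$-Wiener process on a filtered probability space $(\Omega,\mathscr F,(\mathscr F_t)_{t\ge0},\mathbb P)$. Let $f:\mathbb R\to\mathbb R$ be differentiable, and suppose that for some $L_1,\dots,L_5\in\mathbb R$ and $q\ge1$ (with $q\le3$ if $d=3$), for all $\xi,\eta\in\mathbb R$, $$(f(\xi)-f(\eta))(\xi-\eta)\le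 L_1(\xi-\eta)^2,\qquad f(\xi)\xi\le L_2|\xi|^2+L_3,\qquad |f'(\xi)|\le L_4|\xi|^{q-1}+L_5 .$$ Set $F(u):=f\circ u$. Let $g:\mathbb R\to\mathbb R$ be such that $G(x)g_k:=(g\circ x)\,g_k$ defines an operator $G:H\to\mathcal L_2^0$, and suppose that for some $L_6,L_7,L_8\ge0$ and all $x,y\in H$, $$\|G(x)-G(y)\|_{\mathcal L_2^0}^2\le L_6\|x-y\|^2,\qquad \|G(x)\|_{\mathcal L_2^0}^2\le L_7\|x\|^2+L_8 .$$ For $\tau\in(0,1)$, $t_m:=m\tau$ and $x\in H$, a solution of the drift-implicit Euler (DIE) scheme started at $x$ is an $H$-valued process $(X_m^x)_{m\in\mathbb N}$, with $X_m^x$ measurable with respect to $\mathscr F_{t_m}$, such that almost surely $X_0^x=x$ and, for every $m\in\mathbb N$, $X^x_{m+1}\in\dot H^1$ and $$X_{m+1}^x=X_m^x+\tau A X_{m+1}^x+\tau F(X_{m+1}^x)+G(X_m^x)\bigl(W(t_{m+1})-W(t_m)\bigr)\quad\text{in }\dot H^{-1},$$ where $G(X_m^x)(W(t_{m+1})-W(t_m))=\sum_k\langle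 g_k,W(t_{m+1})-W(t_m)\rangle\,G(X_m^x)g_k$ with convergence in $L^2(\Omega;H)$. If such solutions $X^x$ exist for all $x\in H$, put $P_m\phi(x):=\mathbb E\,\phi(X_m^x)$ for bounded continuous $\phi:H\to\mathbb R$. Assume that $L_1+L_6/2<\lambda_1$. Then there is a constant $\gamma_6>0$ (independent of $\tau$, $m$, $x$, $y$ and of the solutions) such that for every $\tau\in(0,1)$, all $x,y\in H$ and all solutions $X^x$, $X^y$ of the DIE scheme started at $x$ and $y$, $$\mathbb E\|X_m^x-X_m^y\|^2\le e^{-\gamma_6t_m}\|x-y\|^2<\infty,\qquad m\in\mathbb N .$$ Consequently $\{P_m\}$ is Feller: if $\phi$ is bounded and continuous on $H$, then so is $P_m\phi$, for every $m\in\mathbb N$. -/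

import Mathlib

open MeasureTheory ProbabilityTheory Filter Topology
open scoped NNReal ENNReal BoundedContinuousFunction

namespace DIE

/-- The Hilbert space `H = L²(O)`. -/
abbrev L2 {d : ℕ} (O : Set (EuclideanSpace ℝ (Fin d))) : Type :=
  Lp ℝ 2 ((volume : Measure (EuclideanSpace ℝ (Fin d))).restrict O)

/-- The space `L²(O; ℝ^d)` of square integrable vector fields, in which gradients live. -/
abbrev L2Vec {d : ℕ} (O : Set (EuclideanSpace ℝ (Fin d))) : Type :=
  Lp (EuclideanSpace ℝ (Fin d)) 2 ((volume : Measure (EuclideanSpace ℝ (Fin d))).restrict O)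

/-- The pairs `(φ, ∇φ)` with `φ` a smooth function compactly supported in `O`. -/
def testGraph {d : ℕ} (O : Set (EuclideanSpace ℝ (Fin d))) : Set (L2 O × L2Vec O) :=
  {w | ∃ φ : EuclideanSpace ℝ (Fin d) → ℝ, ContDiff ℝ (⊤ : ℕ∞) φ ∧ HasCompactSupport φ ∧
    tsupport φ ⊆ O ∧
    (w.1 : EuclideanSpace ℝ (Fin d) → ℝ) =ᵐ[volume.restrict O] φ ∧
    (w.2 : EuclideanSpace ℝ (Fin d) → EuclideanSpace ℝ (Fin d)) =ᵐ[volume.restrict O]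
      gradient φ}

/-- `HasH10Grad O u p` : `u` belongs to `H¹₀(O)`, the closure of the test functions for the
norm of `H¹`, and `p` is its weak gradient. -/
def HasH10Grad {d : ℕ} (O : Set (EuclideanSpace ℝ (Fin d))) (u : L2 O) (p : L2Vec O) : Prop :=
  (u, p) ∈ closure (testGraph O)

/-- `c` is an eigenvalue of `-A`, with `A` the Dirichlet Laplacian on `O`, in weak form:
some `u ≠ 0` in `H¹₀(O)` satisfies `⟨∇u, ∇v⟩ = c ⟨u, v⟩` for all `v` in `H¹₀(O)`. -/
def IsDirichletEigenvalue {d : ℕ} (O : Set (EuclideanSpace ℝ (Fin d))) (c : ℝ) : Prop :=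
  ∃ (u : L2 O) (p : L2Vec O), u ≠ 0 ∧ HasH10Grad O u p ∧
    ∀ (v : L2 O) (r : L2Vec O), HasH10Grad O v r → inner ℝ p r = c * inner ℝ u v

/-- The first eigenvalue `λ₁` of the Dirichlet Laplacian on `O`. -/
noncomputable def firstEigenvalue {d : ℕ} (O : Set (EuclideanSpace ℝ (Fin d))) : ℝ :=
  sInf {c | IsDirichletEigenvalue O c}

/-- The conditions on the drift function `f`. -/
structure DriftCondition (f : ℝ → ℝ) (L₁ L₂ L₃ L₄ L₅ q : ℝ) : Prop where
  differentiable : Differentiable ℝ f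
  monotone : ∀ ξ η : ℝ, (f ξ - f η) * (ξ - η) ≤ L₁ * (ξ - η) ^ 2
  coercive : ∀ ξ : ℝ, f ξ * ξ ≤ L₂ * |ξ| ^ 2 + L₃
  growth : ∀ ξ : ℝ, |deriv f ξ| ≤ L₄ * |ξ| ^ (q - 1) + L₅

/-- `Q` is a positive definite, self-adjoint, trace class operator on `L²(O)`, with orthonormal
basis of eigenvectors `e k` and eigenvalues `κ k`. -/
structure IsCovariance {d : ℕ} {O : Set (EuclideanSpace ℝ (Fin d))}
    (Q : L2 O →L[ℝ] L2 O) (e : HilbertBasis ℕ ℝ (L2 O)) (κ : ℕ → ℝ) : Prop where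
  eigen : ∀ k, Q (e k) = κ k • e k
  pos : ∀ k, 0 < κ k
  trace : Summable κ

open Classical in
/-- The element `ξ ↦ g (x ξ) * h ξ` of `L²(O)`, that is `G(x) h` for the Nemytskii operator `G`
associated with `g` (and `0` when that function is not square integrable). -/
noncomputable def nemytskii {d : ℕ} {O : Set (EuclideanSpace ℝ (Fin d))} (g : ℝ → ℝ)
    (x h : L2 O) : L2 O :=
  if hm : MemLp (fun ξ => g (x ξ) * h ξ) 2 (volume.restrict O) then hm.toLp _ else 0

/-- Squared Hilbert–Schmidt norm from `H₀ = Q^{1/2} H` to `H` of the operator that sends each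
`e k` to `a k`: the vectors `√(κ k) • e k` form an orthonormal basis of `H₀`. -/
noncomputable def hsNormSq {d : ℕ} {O : Set (EuclideanSpace ℝ (Fin d))} (κ : ℕ → ℝ)
    (a : ℕ → L2 O) : ℝ :=
  ∑' k, κ k * ‖a k‖ ^ 2

/-- The Nemytskii operator `G` of `g` maps `H` to the Hilbert–Schmidt operators from `H₀` to `H`
(first two clauses), with Lipschitz continuity and linear growth. -/
structure DiffusionCondition {d : ℕ} {O : Set (EuclideanSpace ℝ (Fin d))}
    (g : ℝ → ℝ) (e : HilbertBasis ℕ ℝ (L2 O)) (κ : ℕ → ℝ) (L₆ L₇ L₈ : ℝ) : Prop where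
  nonneg₆ : 0 ≤ L₆
  nonneg₇ : 0 ≤ L₇
  nonneg₈ : 0 ≤ L₈
  memLp : ∀ (x : L2 O) (k : ℕ), MemLp (fun ξ => g (x ξ) * (e k) ξ) 2 (volume.restrict O)
  summable : ∀ x : L2 O, Summable fun k => κ k * ‖nemytskii g x (e k)‖ ^ 2
  lipschitz : ∀ x y : L2 O,
    hsNormSq κ (fun k => nemytskii g x (e k) - nemytskii g y (e k)) ≤ L₆ * ‖x - y‖ ^ 2
  growth : ∀ x : L2 O, hsNormSq κ (fun k => nemytskii g x (e k)) ≤ L₇ * ‖x‖ ^ 2 + L₈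

/-- `W` is an `L²(O)`-valued `Q`-Wiener process relative to the filtration `𝓕`. -/
structure IsQWiener {d : ℕ} {O : Set (EuclideanSpace ℝ (Fin d))} {Ω : Type*}
    {mΩ : MeasurableSpace Ω} (P : Measure Ω) (𝓕 : Filtration ℝ≥0 mΩ)
    (Q : L2 O →L[ℝ] L2 O) (W : ℝ≥0 → Ω → L2 O) : Prop where
  zero : ∀ᵐ ω ∂P, W 0 ω = 0
  continuous : ∀ᵐ ω ∂P, Continuous fun t => W t ω
  adapted : ∀ t, StronglyMeasurable[𝓕 t] (W t)
  indep : ∀ s t, s ≤ t →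
    Indep (MeasurableSpace.comap (fun ω => W t ω - W s ω) (borel (L2 O))) (𝓕 s) P
  gaussian : ∀ s t, s ≤ t → ∀ h : L2 O,
    P.map (fun ω => inner ℝ h (W t ω - W s ω)) =
      gaussianReal 0 (Real.toNNReal (((t : ℝ) - (s : ℝ)) * inner ℝ h (Q h)))

/-- `N = Φ D` for a random Hilbert–Schmidt operator `Φ` with `Φ (e k) = a k` and a Wiener
increment `D = ∑ ⟨e k, D⟩ e k`: the series `∑ ⟨e k, D⟩ Φ (e k)` has limit `N` in `L²(Ω; H)`. -/
def IsNoiseTerm {d : ℕ} {O : Set (EuclideanSpace ℝ (Fin d))} {Ω : Type*}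
    {mΩ : MeasurableSpace Ω} (P : Measure Ω) (e : HilbertBasis ℕ ℝ (L2 O))
    (a : ℕ → Ω → L2 O) (D : Ω → L2 O) (N : Ω → L2 O) : Prop :=
  AEStronglyMeasurable N P ∧
    Tendsto (fun n : ℕ => eLpNorm
      (fun ω => N ω - ∑ k ∈ Finset.range n, (inner ℝ (e k) (D ω) : ℝ) • a k ω) 2 P)
      atTop (𝓝 0)

/-- `u` lies in `H¹₀(O)` and `u = x + τ A u + τ F(u) + n` in `H⁻¹(O)`, where `A` is the Dirichlet
Laplacian and `F(u) = f ∘ u`. -/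
def IsImplicitStep {d : ℕ} (O : Set (EuclideanSpace ℝ (Fin d))) (f : ℝ → ℝ) (τ : ℝ)
    (x n u : L2 O) : Prop :=
  ∃ p : L2Vec O, HasH10Grad O u p ∧
    ∀ (v : L2 O) (r : L2Vec O), HasH10Grad O v r →
      (inner ℝ u v : ℝ) = inner ℝ x v - τ * inner ℝ p r
        + τ * (∫ ξ in O, f (u ξ) * v ξ) + inner ℝ n v

/-- `X` is a solution, started at `x`, of the drift-implicit Euler scheme
`X (m+1) = X m + τ A X (m+1) + τ F(X (m+1)) + G(X m) (W ((m+1) τ) - W (m τ))`. -/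
structure IsSolution {d : ℕ} {O : Set (EuclideanSpace ℝ (Fin d))} {Ω : Type*}
    {mΩ : MeasurableSpace Ω} (P : Measure Ω) (𝓕 : Filtration ℝ≥0 mΩ)
    (e : HilbertBasis ℕ ℝ (L2 O)) (W : ℝ≥0 → Ω → L2 O) (f g : ℝ → ℝ) (τ : ℝ≥0)
    (x : L2 O) (X : ℕ → Ω → L2 O) : Prop where
  adapted : ∀ m : ℕ, StronglyMeasurable[𝓕 ((m : ℝ≥0) * τ)] (X m)
  init : ∀ᵐ ω ∂P, X 0 ω = x
  step : ∀ m : ℕ, ∃ N : Ω → L2 O,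
    IsNoiseTerm P e (fun k ω => nemytskii g (X m ω) (e k))
      (fun ω => W (((m + 1 : ℕ) : ℝ≥0) * τ) ω - W ((m : ℝ≥0) * τ) ω) N ∧
    ∀ᵐ ω ∂P, IsImplicitStep O f τ (X m ω) (N ω) (X (m + 1) ω)

/-- `(P_m φ)(x) = 𝔼 φ(X_m^x)`, for a family of processes `X x` indexed by the starting point. -/
noncomputable def semigroup {H Ω : Type*} {mΩ : MeasurableSpace Ω} (P : Measure Ω)
    (X : H → ℕ → Ω → H) (m : ℕ) (φ : H → ℝ) (x : H) : ℝ :=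
  ∫ ω, φ (X x m ω) ∂P

end DIE

/-! Both runs are driven by the same noise, so their difference can be followed step by step. Let w
be the difference of the new values u, v, and z the difference of the old values plus that of the
noise terms. Testing the difference of the weak equations with w gives ‖w‖² + τ‖∇w‖² - τ⟨F(u) -
F(v), w⟩ = ⟨z, w⟩. Poincaré, the one-sided Lipschitz bound and Young's inequality turn this into (1
+ τb)‖w‖² ≤ ‖z‖² with b = 2(λ₁ - L₁) (`IsImplicitStep.norm_sub_sq_le`). The Itô isometry bounds
E‖z‖² by (1 + τL₆) times the previous mean square (`integral_norm_add_noise_sq_le`). Since L₆ < b,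
each step contracts by (1 + τL₆)/(1 + τb) ≤ exp(-γτ) with γ = (b - L₆)/(1 + b), and induction
concludes. The Feller property follows by passing to almost surely convergent subsequences
(`exists_semigroup_eq`).

Two analytic facts carry the deterministic step. Since λ₁ is an infimum of eigenvalues, Poincaré
(`firstEigenvalue_mul_norm_sq_le`) needs the infimum of the Rayleigh quotient to be attained. The
required compactness (`exists_subseq_cauchySeq_fst`) comes from Fourier analysis: the gradient
controls high frequencies, weak convergence the low ones. The Sobolev embedding into L^{2q} puts
F(u) in L² (`HasH10Grad.memLp_drift`), so the drift integrals of the two runs can be subtracted. -/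

namespace DIE
open scoped FourierTransform ContDiff

/-! ### Plancherel for test functions and their gradients -/

section Plancherel
variable {d : ℕ} {φ : EuclideanSpace ℝ (Fin d) → ℝ}

theorem gradient_apply_coord (x : EuclideanSpace ℝ (Fin d)) (i : Fin d) :
    gradient φ x i = fderiv ℝ φ x (EuclideanSpace.single i 1) := by
  have h : inner ℝ (gradient φ x) (EuclideanSpace.single i (1 : ℝ))
      = fderiv ℝ φ x (EuclideanSpace.single i 1) := by
    simp [gradient]
  rw [← h, EuclideanSpace.inner_single_right]
  simp

theorem norm_gradient_eq (x : EuclideanSpace ℝ (Fin d)) : ‖gradient φ x‖ = ‖fderiv ℝ φ x‖ := by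
  simp [gradient]

/-- A real test function as a complex valued Schwartz function. -/
noncomputable def complexSchwartz (hφ : ContDiff ℝ ∞ φ) (hc : HasCompactSupport φ) :
    SchwartzMap (EuclideanSpace ℝ (Fin d)) ℂ :=
  HasCompactSupport.toSchwartzMap (f := fun x => (φ x : ℂ))
    (hc.comp_left (g := fun t : ℝ => (t : ℂ)) (by simp))
    (Complex.ofRealCLM.contDiff.comp hφ)

theorem complexSchwartz_apply (hφ : ContDiff ℝ ∞ φ) (hc : HasCompactSupport φ)
    (x : EuclideanSpace ℝ (Fin d)) : complexSchwartz hφ hc x = (φ x : ℂ) := rfl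

theorem integral_norm_sq_fourier_complexSchwartz (hφ : ContDiff ℝ ∞ φ)
    (hc : HasCompactSupport φ) :
    ∫ ξ, ‖𝓕 (complexSchwartz hφ hc) ξ‖ ^ 2 = ∫ x, φ x ^ 2 := by
  rw [SchwartzMap.integral_norm_sq_fourier]
  simp [complexSchwartz_apply]

theorem integrable_norm_sq_schwartz (ψ : SchwartzMap (EuclideanSpace ℝ (Fin d)) ℂ) :
    Integrable fun ξ => ‖ψ ξ‖ ^ 2 :=
  (ψ.memLp 2 volume).integrable_norm_pow (by norm_num)

theorem norm_fourier_lineDeriv (ψ : SchwartzMap (EuclideanSpace ℝ (Fin d)) ℂ)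
    (m ξ : EuclideanSpace ℝ (Fin d)) :
    ‖𝓕 (LineDeriv.lineDerivOp m ψ) ξ‖ ^ 2
      = (2 * Real.pi) ^ 2 * (inner ℝ ξ m ^ 2 * ‖𝓕 ψ ξ‖ ^ 2) := by
  rw [SchwartzMap.fourier_lineDerivOp_eq]
  have : (inner ℝ · m).HasTemperateGrowth :=
    ((innerSL ℝ (E := EuclideanSpace ℝ (Fin d))).flip m).hasTemperateGrowth
  rw [smul_apply, SchwartzMap.smulLeftCLM_apply_apply this]
  simp [mul_pow, abs_of_pos Real.pi_pos]

theorem norm_sq_mul_fourier_eq_sum (ψ : SchwartzMap (EuclideanSpace ℝ (Fin d)) ℂ)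
    (ξ : EuclideanSpace ℝ (Fin d)) :
    (2 * Real.pi) ^ 2 * (‖ξ‖ ^ 2 * ‖𝓕 ψ ξ‖ ^ 2) = ∑ i : Fin d, ‖(𝓕 (LineDeriv.lineDerivOp
      (EuclideanSpace.single i (1 : ℝ)) ψ : SchwartzMap (EuclideanSpace ℝ (Fin d)) ℂ) :
      SchwartzMap (EuclideanSpace ℝ (Fin d)) ℂ) ξ‖ ^ 2 := by
  simp_rw [norm_fourier_lineDeriv, EuclideanSpace.inner_single_right]
  rw [← Finset.mul_sum, ← Finset.sum_mul, EuclideanSpace.real_norm_sq_eq]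
  simp

theorem integrable_norm_sq_mul_fourier (ψ : SchwartzMap (EuclideanSpace ℝ (Fin d)) ℂ) :
    Integrable fun ξ => (2 * Real.pi) ^ 2 * (‖ξ‖ ^ 2 * ‖𝓕 ψ ξ‖ ^ 2) := by
  simp_rw [norm_sq_mul_fourier_eq_sum]
  exact integrable_finsetSum _ fun i _ => integrable_norm_sq_schwartz _

/-- Plancherel for each partial derivative, summed over the coordinates. -/
theorem integral_norm_sq_mul_fourier (hφ : ContDiff ℝ ∞ φ) (hc : HasCompactSupport φ) :
    ∫ ξ, (2 * Real.pi) ^ 2 * (‖ξ‖ ^ 2 * ‖𝓕 (complexSchwartz hφ hc) ξ‖ ^ 2)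
      = ∫ x, ‖gradient φ x‖ ^ 2 := by
  set ψ := complexSchwartz hφ hc
  have h2 : (fun x => ‖gradient φ x‖ ^ 2) = fun x => ∑ i : Fin d,
      ‖(LineDeriv.lineDerivOp (EuclideanSpace.single i (1 : ℝ)) ψ :
        SchwartzMap (EuclideanSpace ℝ (Fin d)) ℂ) x‖ ^ 2 := by
    funext x
    rw [EuclideanSpace.real_norm_sq_eq]
    refine Finset.sum_congr rfl fun i _ => ?_
    rw [gradient_apply_coord, SchwartzMap.lineDerivOp_apply_eq_fderiv]
    have hd : HasFDerivAt (⇑ψ) (Complex.ofRealCLM.comp (fderiv ℝ φ x)) x :=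
      Complex.ofRealCLM.hasFDerivAt.comp x
        ((hφ.differentiable (by simp)).differentiableAt.hasFDerivAt)
    rw [hd.fderiv]
    simp
  simp_rw [norm_sq_mul_fourier_eq_sum]
  rw [h2, integral_finsetSum _ fun i _ => integrable_norm_sq_schwartz _,
    integral_finsetSum _ fun i _ => integrable_norm_sq_schwartz _]
  exact Finset.sum_congr rfl fun i _ => SchwartzMap.integral_norm_sq_fourier _

/-- The `L²` norm of a test function is controlled by its low frequencies and its gradient. -/
theorem integral_sq_le_low_frequency (hφ : ContDiff ℝ ∞ φ) (hc : HasCompactSupport φ)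
    {R : ℝ} (hR : 0 < R) :
    ∫ x, φ x ^ 2 ≤ (∫ ξ in Metric.ball 0 R, ‖𝓕 (complexSchwartz hφ hc) ξ‖ ^ 2)
      + ((2 * Real.pi * R) ^ 2)⁻¹ * ∫ x, ‖gradient φ x‖ ^ 2 := by
  rw [← integral_norm_sq_fourier_complexSchwartz hφ hc, ← integral_norm_sq_mul_fourier hφ hc]
  set ψ := 𝓕 (complexSchwartz hφ hc)
  have hi := integrable_norm_sq_schwartz ψ
  have hj := integrable_norm_sq_mul_fourier (complexSchwartz hφ hc)
  -- Only the frequencies with |ξ| ≥ R remain to be estimated; there 1 ≤ |ξ|²/R².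
  rw [← integral_add_compl Metric.isOpen_ball.measurableSet hi]
  gcongr
  rw [← integral_const_mul]
  have hle : ∀ ξ ∈ (Metric.ball (0 : EuclideanSpace ℝ (Fin d)) R)ᶜ, ‖ψ ξ‖ ^ 2 ≤
      ((2 * Real.pi * R) ^ 2)⁻¹ * ((2 * Real.pi) ^ 2 * (‖ξ‖ ^ 2 * ‖ψ ξ‖ ^ 2)) := by
    intro ξ hξ
    have hξ' : R ≤ ‖ξ‖ := by simpa using hξ
    have h1 : R ^ 2 ≤ ‖ξ‖ ^ 2 := by gcongr
    have h2 : ((2 * Real.pi * R) ^ 2)⁻¹ * ((2 * Real.pi) ^ 2 * (‖ξ‖ ^ 2 * ‖ψ ξ‖ ^ 2))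
      = (‖ξ‖ ^ 2 / R ^ 2) * ‖ψ ξ‖ ^ 2 := by
      have := Real.pi_pos.ne'
      field_simp
    rw [h2]
    exact le_mul_of_one_le_left (by positivity) ((one_le_div (by positivity)).2 h1)
  calc ∫ ξ in (Metric.ball 0 R)ᶜ, ‖ψ ξ‖ ^ 2
      ≤ ∫ ξ in (Metric.ball 0 R)ᶜ,
        ((2 * Real.pi * R) ^ 2)⁻¹ * ((2 * Real.pi) ^ 2 * (‖ξ‖ ^ 2 * ‖ψ ξ‖ ^ 2)) :=
        setIntegral_mono_on hi.integrableOn (hj.const_mul _).integrableOn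
          Metric.isOpen_ball.measurableSet.compl hle
    _ ≤ _ := setIntegral_le_integral (hj.const_mul _) (ae_of_all _ fun ξ => by positivity)

end Plancherel

end DIE

/-! ### Weak compactness and Rellich's theorem -/

namespace DIE
open scoped FourierTransform ContDiff

/-- The coordinate sequences live in a countable product of compact intervals, which replaces the
diagonal argument. Linearity extends convergence to the span of the basis, and density together with
the uniform bound extends the Cauchy property to every `v`. -/
theorem exists_subseq_inner_cauchySeq {H : Type*} [NormedAddCommGroup H] [InnerProductSpace ℝ H]
    (e : HilbertBasis ℕ ℝ H) (u : ℕ → H) {C : ℝ} (hu : ∀ n, ‖u n‖ ≤ C) :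
    ∃ k : ℕ → ℕ, StrictMono k ∧ ∀ v, CauchySeq fun n => (inner ℝ v (u (k n)) : ℝ) := by
  have hcomp : IsCompact (Set.univ.pi fun _ : ℕ => Set.Icc (-C) C) :=
    isCompact_univ_pi fun _ => isCompact_Icc
  obtain ⟨a, -, k, hk, hlim⟩ := hcomp.tendsto_subseq
    (x := fun n i => (inner ℝ (e i) (u n) : ℝ)) (by
      intro n i _
      rw [Set.mem_Icc, ← abs_le]
      calc |(inner ℝ (e i) (u n) : ℝ)| ≤ ‖e i‖ * ‖u n‖ := abs_real_inner_le_norm _ _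
        _ ≤ C := by rw [e.orthonormal.norm_eq_one, one_mul]; exact hu n)
  refine ⟨k, hk, fun v => ?_⟩
  have hspan : ∀ v ∈ Submodule.span ℝ (Set.range e),
      CauchySeq fun n => (inner ℝ v (u (k n)) : ℝ) := by
    intro v hv
    induction hv using Submodule.span_induction with
    | mem x hx =>
      obtain ⟨i, rfl⟩ := hx
      exact ((tendsto_pi_nhds.1 hlim) i).cauchySeq
    | zero => simpa using cauchySeq_const (0 : ℝ)
    | add x y _ _ hx hy => simpa only [inner_add_left] using! hx.add hy
    | smul c x _ hx =>
      simp only [real_inner_smul_left]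
      exact (uniformContinuous_const_smul c).comp_cauchySeq hx
  have hC : 0 ≤ C := (norm_nonneg _).trans (hu 0)
  rw [Metric.cauchySeq_iff']
  intro ε hε
  obtain ⟨v', hv', hd⟩ : ∃ v' ∈ Submodule.span ℝ (Set.range e), dist v v' < ε / (3 * (C + 1)) := by
    have : v ∈ (Submodule.span ℝ (Set.range e)).topologicalClosure := by
      rw [e.dense_span]; trivial
    exact Metric.mem_closure_iff.1 this _ (by positivity)
  obtain ⟨N, hN⟩ := Metric.cauchySeq_iff'.1 (hspan v' hv') (ε / 3) (by positivity)
  refine ⟨N, fun n hn => ?_⟩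
  have h1 := hN n hn
  have h2 : ∀ n, |(inner ℝ (v - v') (u n) : ℝ)| < ε / 3 := by
    intro n
    calc |(inner ℝ (v - v') (u n) : ℝ)| ≤ ‖v - v'‖ * ‖u n‖ := abs_real_inner_le_norm _ _
      _ ≤ ‖v - v'‖ * (C + 1) := by gcongr; linarith [hu n]
      _ < ε / (3 * (C + 1)) * (C + 1) := by rw [← dist_eq_norm]; gcongr
      _ = ε / 3 := by field_simp
  have h3 := h2 (k n)
  have h4 := h2 (k N)
  rw [Real.dist_eq] at h1 ⊢
  rw [inner_sub_left] at h3 h4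
  rw [abs_lt] at *
  constructor <;> linarith [h1.1, h1.2, h3.1, h3.2, h4.1, h4.2]

variable {d : ℕ} {O : Set (EuclideanSpace ℝ (Fin d))}

theorem gradient_add' {φ ψ : EuclideanSpace ℝ (Fin d) → ℝ} (hφ : Differentiable ℝ φ)
    (hψ : Differentiable ℝ ψ) :
    gradient (fun x => φ x + ψ x) = fun x => gradient φ x + gradient ψ x := by
  funext x
  simp [gradient, fderiv_fun_add hφ.differentiableAt hψ.differentiableAt]

theorem gradient_const_mul' {φ : EuclideanSpace ℝ (Fin d) → ℝ} (hφ : Differentiable ℝ φ) (c : ℝ) :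
    gradient (fun x => c * φ x) = fun x => c • gradient φ x := by
  funext x
  simp [gradient, fderiv_const_mul hφ.differentiableAt]

/-- The test functions with their gradients, as a linear subspace. -/
def testSubmodule (O : Set (EuclideanSpace ℝ (Fin d))) : Submodule ℝ (L2 O × L2Vec O) where
  carrier := testGraph O
  zero_mem' := by
    refine ⟨fun _ => 0, contDiff_const, HasCompactSupport.zero, by simp [tsupport], ?_, ?_⟩
    · exact Lp.coeFn_zero _ _ _
    · have : gradient (fun _ : EuclideanSpace ℝ (Fin d) => (0 : ℝ)) = 0 := by
        funext x; simp [gradient]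
      rw [this]
      exact Lp.coeFn_zero _ _ _
  add_mem' := by
    rintro a b ⟨φ, hφ, hφc, hφO, ha1, ha2⟩ ⟨ψ, hψ, hψc, hψO, hb1, hb2⟩
    refine ⟨fun x => φ x + ψ x, hφ.add hψ, hφc.add hψc,
      (tsupport_add φ ψ).trans (Set.union_subset hφO hψO), ?_, ?_⟩
    · filter_upwards [ha1, hb1, Lp.coeFn_add a.1 b.1] with x h1 h2 h3
      rw [Prod.fst_add, h3, Pi.add_apply, h1, h2]
    · rw [gradient_add' (hφ.differentiable (by simp)) (hψ.differentiable (by simp))]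
      filter_upwards [ha2, hb2, Lp.coeFn_add a.2 b.2] with x h1 h2 h3
      rw [Prod.snd_add, h3, Pi.add_apply, h1, h2]
  smul_mem' := by
    rintro c a ⟨φ, hφ, hφc, hφO, ha1, ha2⟩
    refine ⟨fun x => c * φ x, contDiff_const.mul hφ, hφc.mul_left,
      (tsupport_mul_subset_right (f := fun _ => c) (g := φ)).trans hφO, ?_, ?_⟩
    · filter_upwards [ha1, Lp.coeFn_smul c a.1] with x h1 h3
      rw [Prod.smul_fst, h3, Pi.smul_apply, h1, smul_eq_mul]
    · rw [gradient_const_mul' (hφ.differentiable (by simp))]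
      filter_upwards [ha2, Lp.coeFn_smul c a.2] with x h1 h3
      rw [Prod.smul_snd, h3, Pi.smul_apply, h1]

theorem HasH10Grad.sub {u v : L2 O} {p r : L2Vec O} (hu : HasH10Grad O u p)
    (hv : HasH10Grad O v r) : HasH10Grad O (u - v) (p - r) :=
  (testSubmodule O).topologicalClosure.sub_mem hu hv

theorem HasH10Grad.add {u v : L2 O} {p r : L2Vec O} (hu : HasH10Grad O u p)
    (hv : HasH10Grad O v r) : HasH10Grad O (u + v) (p + r) :=
  (testSubmodule O).topologicalClosure.add_mem hu hv

theorem HasH10Grad.smul {u : L2 O} {p : L2Vec O} (c : ℝ) (hu : HasH10Grad O u p) :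
    HasH10Grad O (c • u) (c • p) :=
  (testSubmodule O).topologicalClosure.smul_mem c hu

theorem Lp_two_norm_sq {α F : Type*} [MeasurableSpace α] {μ : Measure α} [NormedAddCommGroup F]
    [InnerProductSpace ℝ F] (u : Lp F 2 μ) : ‖u‖ ^ 2 = ∫ x, ‖u x‖ ^ 2 ∂μ := by
  rw [← real_inner_self_eq_norm_sq, L2.inner_def]
  simp

theorem setIntegral_eq_integral_of_tsupport_subset {φ : EuclideanSpace ℝ (Fin d) → ℝ} {F : Type*}
    [NormedAddCommGroup F] [NormedSpace ℝ F] (h : EuclideanSpace ℝ (Fin d) → F)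
    (hφ : tsupport φ ⊆ O) (hh : ∀ x, x ∉ tsupport φ → h x = 0) : ∫ x in O, h x = ∫ x, h x :=
  setIntegral_eq_integral_of_forall_compl_eq_zero fun x hx => hh x fun hx' => hx (hφ hx')

section Rellich
variable [IsFiniteMeasure ((volume : Measure (EuclideanSpace ℝ (Fin d))).restrict O)]

theorem memLp_of_continuous_of_bound {h : EuclideanSpace ℝ (Fin d) → ℝ} (hc : Continuous h)
    (hb : ∀ x, |h x| ≤ 1) : MemLp h 2 (volume.restrict O) :=
  MemLp.of_bound hc.aestronglyMeasurable 1 (ae_of_all _ hb)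

variable (O) in
/-- The real part of the character with frequency `ξ`. -/
noncomputable def cosMode (ξ : EuclideanSpace ℝ (Fin d)) : L2 O :=
  (memLp_of_continuous_of_bound (O := O) (h := fun x => Real.cos (2 * Real.pi * inner ℝ x ξ))
    (by fun_prop) fun _ => Real.abs_cos_le_one _).toLp _

variable (O) in
/-- The imaginary part of the character with frequency `ξ`. -/
noncomputable def sinMode (ξ : EuclideanSpace ℝ (Fin d)) : L2 O :=
  (memLp_of_continuous_of_bound (O := O) (h := fun x => Real.sin (2 * Real.pi * inner ℝ x ξ))
    (by fun_prop) fun _ => Real.abs_sin_le_one _).toLp _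

/-- Characters are bounded by 1 on a set of finite measure. Uniformity in the frequency supplies the
dominating constant in the Rellich argument. -/
theorem exists_norm_mode_le : ∃ K : ℝ, ∀ ξ, ‖cosMode O ξ‖ ≤ K ∧ ‖sinMode O ξ‖ ≤ K := by
  refine ⟨_, fun ξ => ⟨Lp.norm_le_of_ae_bound zero_le_one ?_,
    Lp.norm_le_of_ae_bound zero_le_one ?_⟩⟩
  · filter_upwards [MemLp.coeFn_toLp (memLp_of_continuous_of_bound (O := O)
      (h := fun x => Real.cos (2 * Real.pi * inner ℝ x ξ))
      (by fun_prop) fun _ => Real.abs_cos_le_one _)] with x hx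
    rw [cosMode, hx]
    exact Real.abs_cos_le_one _
  · filter_upwards [MemLp.coeFn_toLp (memLp_of_continuous_of_bound (O := O)
      (h := fun x => Real.sin (2 * Real.pi * inner ℝ x ξ))
      (by fun_prop) fun _ => Real.abs_sin_le_one _)] with x hx
    rw [sinMode, hx]
    exact Real.abs_sin_le_one _

/-- Together with `inner_sinMode`, this makes the Fourier transform at a fixed frequency a pair of
continuous functionals on L²(O), so weak Cauchy sequences have pointwise Cauchy transforms. -/
theorem inner_cosMode {φ : EuclideanSpace ℝ (Fin d) → ℝ} (hφ : ContDiff ℝ ∞ φ)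
    (hc : HasCompactSupport φ) (hO : tsupport φ ⊆ O) {u : L2 O}
    (hu : (u : EuclideanSpace ℝ (Fin d) → ℝ) =ᵐ[volume.restrict O] φ)
    (ξ : EuclideanSpace ℝ (Fin d)) :
    inner ℝ (cosMode O ξ) u = (𝓕 (complexSchwartz hφ hc) ξ).re := by
  rw [SchwartzMap.fourier_coe, Real.fourier_eq, L2.inner_def,
    ← Complex.reCLM_apply, ← ContinuousLinearMap.integral_comp_comm]
  · rw [← setIntegral_eq_integral_of_tsupport_subset (O := O) (φ := φ) _ hO]
    · refine integral_congr_ae ?_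
      filter_upwards [hu, MemLp.coeFn_toLp (memLp_of_continuous_of_bound (O := O)
        (h := fun x => Real.cos (2 * Real.pi * inner ℝ x ξ))
        (by fun_prop) fun _ => Real.abs_cos_le_one _)] with x h1 h2
      rw [cosMode, h1, h2, complexSchwartz_apply, Circle.smul_def, Real.fourierChar_apply]
      simp [Complex.exp_re, mul_comm]
    · intro x hx
      simp [complexSchwartz_apply, image_eq_zero_of_notMem_tsupport hx]
  · exact (Real.fourierIntegral_convergent_iff ξ).2 (complexSchwartz hφ hc).integrable

theorem inner_sinMode {φ : EuclideanSpace ℝ (Fin d) → ℝ} (hφ : ContDiff ℝ ∞ φ)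
    (hc : HasCompactSupport φ) (hO : tsupport φ ⊆ O) {u : L2 O}
    (hu : (u : EuclideanSpace ℝ (Fin d) → ℝ) =ᵐ[volume.restrict O] φ)
    (ξ : EuclideanSpace ℝ (Fin d)) :
    inner ℝ (sinMode O ξ) u = -(𝓕 (complexSchwartz hφ hc) ξ).im := by
  rw [SchwartzMap.fourier_coe, Real.fourier_eq, L2.inner_def,
    ← Complex.imCLM_apply, ← ContinuousLinearMap.integral_comp_comm, ← integral_neg]
  · rw [← setIntegral_eq_integral_of_tsupport_subset (O := O) (φ := φ) _ hO]
    · refine integral_congr_ae ?_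
      filter_upwards [hu, MemLp.coeFn_toLp (memLp_of_continuous_of_bound (O := O)
        (h := fun x => Real.sin (2 * Real.pi * inner ℝ x ξ))
        (by fun_prop) fun _ => Real.abs_sin_le_one _)] with x h1 h2
      rw [sinMode, h1, h2, complexSchwartz_apply, Circle.smul_def, Real.fourierChar_apply]
      simp [Complex.exp_im, mul_comm]
    · intro x hx
      simp [complexSchwartz_apply, image_eq_zero_of_notMem_tsupport hx]
  · exact (Real.fourierIntegral_convergent_iff ξ).2 (complexSchwartz hφ hc).integrable

/-- The frequency splitting expressed through the modes alone, ready for differences of members of a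
sequence. The continuity clause provides measurability for dominated convergence. -/
theorem testGraph_low_frequency {w : L2 O × L2Vec O} (hw : w ∈ testGraph O) :
    Continuous (fun ξ => inner ℝ (cosMode O ξ) w.1 ^ 2 + inner ℝ (sinMode O ξ) w.1 ^ 2) ∧
    ∀ R : ℝ, 0 < R → ‖w.1‖ ^ 2 ≤ (∫ ξ in Metric.ball 0 R,
      (inner ℝ (cosMode O ξ) w.1 ^ 2 + inner ℝ (sinMode O ξ) w.1 ^ 2))
      + ((2 * Real.pi * R) ^ 2)⁻¹ * ‖w.2‖ ^ 2 := by
  obtain ⟨φ, hφ, hc, hO, h1, h2⟩ := hw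
  have hF : ∀ ξ, inner ℝ (cosMode O ξ) w.1 ^ 2 + inner ℝ (sinMode O ξ) w.1 ^ 2
      = ‖𝓕 (complexSchwartz hφ hc) ξ‖ ^ 2 := by
    intro ξ
    rw [inner_cosMode hφ hc hO h1, inner_sinMode hφ hc hO h1, Complex.sq_norm,
      Complex.normSq_apply]
    ring
  have hn1 : ‖w.1‖ ^ 2 = ∫ x, φ x ^ 2 := by
    rw [Lp_two_norm_sq, ← setIntegral_eq_integral_of_tsupport_subset (O := O) _ hO]
    · refine integral_congr_ae ?_
      filter_upwards [h1] with x hx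
      simp [hx]
    · intro x hx
      simp [image_eq_zero_of_notMem_tsupport hx]
  have hn2 : ‖w.2‖ ^ 2 = ∫ x, ‖gradient φ x‖ ^ 2 := by
    rw [Lp_two_norm_sq, ← setIntegral_eq_integral_of_tsupport_subset (O := O) _ hO]
    · refine integral_congr_ae ?_
      filter_upwards [h2] with x hx
      simp [hx]
    · intro x hx
      rw [norm_gradient_eq, image_eq_zero_of_notMem_tsupport
        fun h => hx (tsupport_fderiv_subset ℝ h)]
      simp
  simp_rw [hF, hn1, hn2]
  exact ⟨by fun_prop, fun R hR => integral_sq_le_low_frequency hφ hc hR⟩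

/-- Rellich compactness for test functions. -/
theorem exists_subseq_cauchySeq_fst (e : HilbertBasis ℕ ℝ (L2 O)) (w : ℕ → L2 O × L2Vec O)
    (hw : ∀ n, w n ∈ testGraph O) {C : ℝ} (h1 : ∀ n, ‖(w n).1‖ ≤ C) (h2 : ∀ n, ‖(w n).2‖ ≤ C) :
    ∃ k : ℕ → ℕ, StrictMono k ∧ CauchySeq fun n => (w (k n)).1 := by
  obtain ⟨k, hk, hcau⟩ := exists_subseq_inner_cauchySeq e (fun n => (w n).1) h1
  refine ⟨k, hk, ?_⟩
  have hC : 0 ≤ C := (norm_nonneg _).trans (h1 0)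
  obtain ⟨K, hK⟩ := exists_norm_mode_le (O := O)
  -- Indexing differences by pairs turns the Cauchy property into convergence to 0 along `atTop` on
  -- ℕ × ℕ.
  set D : ℕ × ℕ → L2 O × L2Vec O := fun n => w (k n.1) - w (k n.2) with hD
  have hDt : ∀ n, D n ∈ testGraph O := fun n => (testSubmodule O).sub_mem (hw _) (hw _)
  have hD1 : ∀ n, ‖(D n).1‖ ≤ 2 * C := fun n => by
    rw [hD, Prod.fst_sub]
    linarith [norm_sub_le (w (k n.1)).1 (w (k n.2)).1, h1 (k n.1), h1 (k n.2)]
  have hD2 : ∀ n, ‖(D n).2‖ ≤ 2 * C := fun n => by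
    rw [hD, Prod.snd_sub]
    linarith [norm_sub_le (w (k n.1)).2 (w (k n.2)).2, h2 (k n.1), h2 (k n.2)]
  have hDw : ∀ v : L2 O, Tendsto (fun n => (inner ℝ v (D n).1 : ℝ) ^ 2) atTop (𝓝 0) := by
    intro v
    have := (cauchySeq_iff_tendsto_dist_atTop_0.1 (hcau v)).pow 2
    simpa [hD, Real.dist_eq, inner_sub_right] using this
  have hKD : ∀ (v : L2 O) n, ‖v‖ ≤ K → (inner ℝ v (D n).1 : ℝ) ^ 2 ≤ (K * (2 * C)) ^ 2 := by
    intro v n hv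
    rw [← sq_abs]
    have := (abs_real_inner_le_norm v (D n).1).trans
      (mul_le_mul hv (hD1 n) (norm_nonneg _) ((norm_nonneg _).trans hv))
    gcongr
  have hlow : ∀ R : ℝ, Tendsto (fun n => ∫ ξ in Metric.ball 0 R,
      ((inner ℝ (cosMode O ξ) (D n).1 : ℝ) ^ 2 + (inner ℝ (sinMode O ξ) (D n).1 : ℝ) ^ 2))
      atTop (𝓝 0) := by
    intro R
    have hfin : IsFiniteMeasure ((volume : Measure (EuclideanSpace ℝ (Fin d))).restrict
        (Metric.ball 0 R)) := isFiniteMeasure_restrict.2 measure_ball_lt_top.ne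
    have := tendsto_integral_filter_of_dominated_convergence
      (μ := (volume : Measure (EuclideanSpace ℝ (Fin d))).restrict (Metric.ball 0 R))
      (l := (atTop : Filter (ℕ × ℕ)))
      (F := fun n ξ => (inner ℝ (cosMode O ξ) (D n).1 : ℝ) ^ 2
        + (inner ℝ (sinMode O ξ) (D n).1 : ℝ) ^ 2) (f := fun _ => (0 : ℝ))
      (fun _ => (K * (2 * C)) ^ 2 + (K * (2 * C)) ^ 2)
      (Eventually.of_forall fun n => (testGraph_low_frequency (hDt n)).1.aestronglyMeasurable)
      (Eventually.of_forall fun n => ae_of_all _ fun ξ => by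
        rw [Real.norm_of_nonneg (by positivity)]
        exact add_le_add (hKD _ n (hK ξ).1) (hKD _ n (hK ξ).2))
      (integrable_const _)
      (ae_of_all _ fun ξ => by simpa using (hDw (cosMode O ξ)).add (hDw (sinMode O ξ)))
    simpa using this
  rw [cauchySeq_iff_tendsto_dist_atTop_0]
  have hsq : Tendsto (fun n => ‖(D n).1‖ ^ 2) atTop (𝓝 0) := by
    rw [Metric.tendsto_nhds]
    intro ε hε
    -- First R is fixed to make the high-frequency tail small uniformly in n; only then is n taken
    -- large for the low frequencies.
    have hR : Tendsto (fun R : ℝ => ((2 * Real.pi * R) ^ 2)⁻¹ * (2 * C) ^ 2) atTop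
        (𝓝 (0 * (2 * C) ^ 2)) :=
      (tendsto_inv_atTop_zero.comp ((tendsto_pow_atTop (by norm_num)).comp
        (tendsto_id.const_mul_atTop (by positivity)))).mul_const _
    rw [zero_mul] at hR
    obtain ⟨R, hRε, hR0⟩ := ((hR.eventually (gt_mem_nhds (half_pos hε))).and
      (eventually_gt_atTop 0)).exists
    filter_upwards [(hlow R).eventually (gt_mem_nhds (half_pos hε))] with n hn
    have h3 := (testGraph_low_frequency (hDt n)).2 R hR0
    have h4 : ((2 * Real.pi * R) ^ 2)⁻¹ * ‖(D n).2‖ ^ 2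
        ≤ ((2 * Real.pi * R) ^ 2)⁻¹ * (2 * C) ^ 2 := by
      gcongr
      exact hD2 n
    rw [Real.dist_eq, sub_zero, abs_of_nonneg (by positivity)]
    linarith
  have := hsq.sqrt
  simpa [hD, dist_eq_norm, Real.sqrt_sq] using this

end Rellich
end DIE

/-! ### Rayleigh quotient and the Poincaré inequality -/

namespace DIE

variable {d : ℕ} {O : Set (EuclideanSpace ℝ (Fin d))}

/-- First variation at a minimum: the choice t = -a/(|b| + 1) is small enough for the linear term to
win, whatever the sign of b. -/
theorem eq_zero_of_forall_quadratic_nonneg {a b : ℝ} (h : ∀ t : ℝ, 0 ≤ 2 * t * a + t ^ 2 * b) :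
    a = 0 := by
  have hb : 0 < |b| + 1 := by positivity
  have h1 := h (-a / (|b| + 1))
  have h2 : 2 * (-a / (|b| + 1)) * a + (-a / (|b| + 1)) ^ 2 * b
      = a ^ 2 * (b - 2 * (|b| + 1)) / (|b| + 1) ^ 2 := by
    field_simp
    ring
  rw [h2, le_div_iff₀ (by positivity), zero_mul] at h1
  have h3 : b - 2 * (|b| + 1) < 0 := by linarith [le_abs_self b]
  have h4 : a ^ 2 ≤ 0 := by
    by_contra hc
    push Not at hc
    nlinarith [mul_neg_of_pos_of_neg hc h3]
  exact pow_eq_zero_iff two_ne_zero |>.1 (le_antisymm h4 (sq_nonneg a))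

/-- An eigenfunction tested with itself forces c ≥ 0. Without a lower bound the real `sInf` would be
a default value. -/
theorem bddBelow_dirichletEigenvalues (O : Set (EuclideanSpace ℝ (Fin d))) :
    BddBelow {c | IsDirichletEigenvalue O c} := by
  refine ⟨0, ?_⟩
  rintro c ⟨u, p, hu, hup, h⟩
  have h1 := h u p hup
  rw [real_inner_self_eq_norm_sq, real_inner_self_eq_norm_sq] at h1
  have h2 : 0 < ‖u‖ ^ 2 := by positivity
  by_contra hc
  push Not at hc
  nlinarith [mul_neg_of_neg_of_pos hc h2, sq_nonneg ‖p‖]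

theorem HasH10Grad.mem_of_isClosed {u : L2 O} {p : L2Vec O} (hu : HasH10Grad O u p)
    {s : Set (L2 O × L2Vec O)} (hs : IsClosed s) (h : ∀ w ∈ testGraph O, w ∈ s) : (u, p) ∈ s :=
  closure_minimal h hs hu

/-- A minimizer of the Rayleigh quotient is an eigenfunction. -/
theorem isDirichletEigenvalue_of_minimizer {μ : ℝ} {u : L2 O} {p : L2Vec O} (hu : u ≠ 0)
    (hup : HasH10Grad O u p) (heq : ‖p‖ ^ 2 = μ * ‖u‖ ^ 2)
    (hmin : ∀ (v : L2 O) (r : L2Vec O), HasH10Grad O v r → μ * ‖v‖ ^ 2 ≤ ‖r‖ ^ 2) :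
    IsDirichletEigenvalue O μ := by
  refine ⟨u, p, hu, hup, fun v r hv => ?_⟩
  rw [← sub_eq_zero]
  refine eq_zero_of_forall_quadratic_nonneg (b := ‖r‖ ^ 2 - μ * ‖v‖ ^ 2) fun t => ?_
  -- The form ‖∇·‖² - μ‖·‖² is nonnegative and vanishes at u, so its first variation there must
  -- vanish.
  have h := hmin _ _ (hup.add (hv.smul t))
  rw [norm_add_sq_real, norm_add_sq_real, real_inner_smul_right, real_inner_smul_right,
    norm_smul, norm_smul, mul_pow, mul_pow, Real.norm_eq_abs, sq_abs] at h
  nlinarith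

/-- The Poincaré inequality with the first Dirichlet eigenvalue as constant. -/
theorem firstEigenvalue_mul_norm_sq_le
    [IsFiniteMeasure ((volume : Measure (EuclideanSpace ℝ (Fin d))).restrict O)]
    (e : HilbertBasis ℕ ℝ (L2 O)) {u : L2 O} {p : L2Vec O} (hup : HasH10Grad O u p) :
    firstEigenvalue O * ‖u‖ ^ 2 ≤ ‖p‖ ^ 2 := by
  rcases eq_or_ne u 0 with rfl | hu
  · simp
  set S : Set ℝ := {r | ∃ w ∈ testGraph O, ‖w.1‖ = 1 ∧ r = ‖w.2‖ ^ 2} with hS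
  have hSb : BddBelow S := ⟨0, by rintro _ ⟨w, -, -, rfl⟩; positivity⟩
  set μ := sInf S with hμ
  have hnormalize : ∀ w ∈ testGraph O, w.1 ≠ 0 → ‖w.2‖ ^ 2 / ‖w.1‖ ^ 2 ∈ S := by
    intro w hw h0
    have h0' : 0 < ‖w.1‖ := norm_pos_iff.2 h0
    refine ⟨‖w.1‖⁻¹ • w, (testSubmodule O).smul_mem _ hw, ?_, ?_⟩
    · rw [Prod.smul_fst, norm_smul, norm_inv, norm_norm, inv_mul_cancel₀ h0'.ne']
    · rw [Prod.smul_snd, norm_smul, norm_inv, norm_norm]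
      field_simp
  have htest : ∀ w ∈ testGraph O, μ * ‖w.1‖ ^ 2 ≤ ‖w.2‖ ^ 2 := by
    intro w hw
    by_cases h0 : w.1 = 0
    · simp [h0]
    · have h0' : 0 < ‖w.1‖ ^ 2 := by positivity
      exact (le_div_iff₀ h0').1 (csInf_le hSb (hnormalize w hw h0))
  have hclos : ∀ (v : L2 O) (r : L2Vec O), HasH10Grad O v r → μ * ‖v‖ ^ 2 ≤ ‖r‖ ^ 2 := by
    intro v r hv
    have hcl : IsClosed {w : L2 O × L2Vec O | μ * ‖w.1‖ ^ 2 ≤ ‖w.2‖ ^ 2} :=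
      isClosed_le (continuous_const.mul (continuous_fst.norm.pow 2)) (continuous_snd.norm.pow 2)
    exact hv.mem_of_isClosed hcl htest
  -- If all test functions vanished in L², so would their closure, contrary to `u ≠ 0`.
  have hSne : S.Nonempty := by
    by_contra hne
    rw [Set.not_nonempty_iff_eq_empty] at hne
    have h0 : ∀ w ∈ testGraph O, w.1 = 0 := by
      intro w hw
      by_contra h0
      have := hnormalize w hw h0
      rw [hne] at this
      exact this
    have hcl : IsClosed {w : L2 O × L2Vec O | w.1 = 0} :=
      isClosed_eq continuous_fst continuous_const
    exact hu (hup.mem_of_isClosed hcl h0)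
  obtain ⟨s, -, hs, hsS⟩ := exists_seq_tendsto_sInf hSne hSb
  choose w hwt hw1 hw2 using hsS
  obtain ⟨B, hB⟩ := hs.bddAbove_range
  have hB' : ∀ n, ‖(w n).2‖ ^ 2 ≤ B := fun n => hw2 n ▸ hB ⟨n, rfl⟩
  have hB0 : 0 ≤ B := (sq_nonneg _).trans (hB' 0)
  obtain ⟨k, hk, hcau⟩ := exists_subseq_cauchySeq_fst e w hwt (C := 1 + B)
    (fun n => by rw [hw1]; linarith)
    (fun n => by nlinarith [hB' n, sq_nonneg (‖(w n).2‖ - 1)])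
  have hlim : Tendsto (fun n => ‖(w (k n)).2‖ ^ 2) atTop (𝓝 μ) := by
    simp_rw [← hw2]
    exact hs.comp hk.tendsto_atTop
  -- The parallelogram law makes the gradients of a minimizing sequence Cauchy: ‖wₙ + wₘ‖² tends to
  -- 4, so the gradient of the sum has squared norm at least nearly 4μ, leaving nothing for the
  -- difference. Thus the limit is a strong one and attains μ.
  have hgcau : CauchySeq fun n => (w (k n)).2 := by
    rw [cauchySeq_iff_tendsto_dist_atTop_0]
    have hfst : Tendsto (fun n : ℕ × ℕ => n.1) atTop atTop := by
      rw [← prod_atTop_atTop_eq]; exact tendsto_fst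
    have hsnd : Tendsto (fun n : ℕ × ℕ => n.2) atTop atTop := by
      rw [← prod_atTop_atTop_eq]; exact tendsto_snd
    have hd := (cauchySeq_iff_tendsto_dist_atTop_0.1 hcau).pow 2
    have hbound : Tendsto (fun n : ℕ × ℕ => 2 * ‖(w (k n.1)).2‖ ^ 2 + 2 * ‖(w (k n.2)).2‖ ^ 2
        - μ * (4 - dist (w (k n.1)).1 (w (k n.2)).1 ^ 2)) atTop
        (𝓝 (2 * μ + 2 * μ - μ * (4 - 0 ^ 2))) :=
      (((hlim.comp hfst).const_mul 2).add ((hlim.comp hsnd).const_mul 2)).sub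
        ((hd.const_sub 4).const_mul μ)
    have h0 : 2 * μ + 2 * μ - μ * (4 - 0 ^ 2) = 0 := by ring
    rw [h0] at hbound
    have hsq : Tendsto (fun n : ℕ × ℕ => ‖(w (k n.1)).2 - (w (k n.2)).2‖ ^ 2) atTop (𝓝 0) := by
      refine squeeze_zero (fun _ => by positivity) (fun n => ?_) hbound
      have h1 := parallelogram_law_with_norm ℝ (w (k n.1)).2 (w (k n.2)).2
      have h2 := parallelogram_law_with_norm ℝ (w (k n.1)).1 (w (k n.2)).1
      have h3 := htest _ ((testSubmodule O).add_mem (hwt (k n.1)) (hwt (k n.2)))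
      rw [Prod.fst_add, Prod.snd_add] at h3
      rw [hw1, hw1] at h2
      rw [dist_eq_norm]
      have h4 : ‖(w (k n.1)).1 + (w (k n.2)).1‖ ^ 2
          = 4 - ‖(w (k n.1)).1 - (w (k n.2)).1‖ ^ 2 := by linarith
      rw [h4] at h3
      linarith
    simpa [dist_eq_norm, Real.sqrt_sq] using hsq.sqrt
  obtain ⟨u₀, hu₀⟩ := cauchySeq_tendsto_of_complete hcau
  obtain ⟨p₀, hp₀⟩ := cauchySeq_tendsto_of_complete hgcau
  have hH : HasH10Grad O u₀ p₀ :=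
    mem_closure_of_tendsto (hu₀.prodMk_nhds hp₀) (Eventually.of_forall fun n => hwt (k n))
  have hn : ‖u₀‖ = 1 := by
    refine tendsto_nhds_unique hu₀.norm ?_
    simp [hw1]
  have hp : ‖p₀‖ ^ 2 = μ := tendsto_nhds_unique (hp₀.norm.pow 2) hlim
  have heig : IsDirichletEigenvalue O μ :=
    isDirichletEigenvalue_of_minimizer (by rw [← norm_pos_iff, hn]; exact one_pos) hH
      (by rw [hp, hn]; ring) hclos
  -- Only this direction is needed: μ is an eigenvalue, so the least one cannot exceed it.
  have hle : firstEigenvalue O ≤ μ := csInf_le (bddBelow_dirichletEigenvalues O) heig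
  exact (mul_le_mul_of_nonneg_right hle (sq_nonneg _)).trans (hclos u p hup)

end DIE

/-! ### Sobolev embedding and square integrability of the drift -/

namespace DIE

variable {d : ℕ} {O : Set (EuclideanSpace ℝ (Fin d))}

theorem support_fderiv_subset_of_tsupport_subset {φ : EuclideanSpace ℝ (Fin d) → ℝ}
    (hO : tsupport φ ⊆ O) : Function.support (fderiv ℝ φ) ⊆ O :=
  (subset_tsupport _).trans ((tsupport_fderiv_subset ℝ).trans hO)

/-- Hölder on O, where the derivative is supported. -/
theorem eLpNorm_fderiv_le {φ : EuclideanSpace ℝ (Fin d) → ℝ}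
    (hφ : ContDiff ℝ 1 φ) (hO : tsupport φ ⊆ O) {p : ℝ≥0∞} (hp : p ≤ 2) :
    eLpNorm (fderiv ℝ φ) p volume ≤ eLpNorm (fderiv ℝ φ) 2 (volume.restrict O)
      * (volume.restrict O) Set.univ ^ (1 / p.toReal - 1 / (2 : ℝ≥0∞).toReal) := by
  have hs : Function.support (fun x => ‖fderiv ℝ φ x‖) ⊆ O := by
    simpa [Function.support] using support_fderiv_subset_of_tsupport_subset hO
  rw [← eLpNorm_norm (fderiv ℝ φ), ← eLpNorm_restrict_eq_of_support_subset hs, eLpNorm_norm]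
  exact eLpNorm_le_eLpNorm_mul_rpow_measure_univ hp
    (hφ.continuous_fderiv (by simp)).aestronglyMeasurable

/-- The fundamental theorem of calculus, transported along an isometry with ℝ. Dimension one is
separate because the general Sobolev inequality asks for 1 ≤ p < d. -/
theorem enorm_le_eLpNorm_fderiv_one {φ : EuclideanSpace ℝ (Fin 1) → ℝ} (hφ : ContDiff ℝ 1 φ)
    (hc : HasCompactSupport φ) (x : EuclideanSpace ℝ (Fin 1)) :
    ‖φ x‖ₑ ≤ eLpNorm (fderiv ℝ φ) 1 volume := by
  let I := (OrthonormalBasis.singleton (Fin 1) ℝ).repr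
  have hI : ContDiff ℝ 1 (φ ∘ I) := hφ.comp I.contDiff
  have hIc : HasCompactSupport (φ ∘ I) := hc.comp_homeomorph I.toHomeomorph
  have hderiv : ∀ t, ‖deriv (φ ∘ I) t‖ₑ ≤ ‖fderiv ℝ φ (I t)‖ₑ := by
    intro t
    have h1 : HasDerivAt (φ ∘ I) (fderiv ℝ φ (I t) (I 1)) t := by
      have h2 : HasFDerivAt (φ ∘ I) ((fderiv ℝ φ (I t)).comp
          (I.toContinuousLinearEquiv : ℝ →L[ℝ] EuclideanSpace ℝ (Fin 1))) t :=
        ((hφ.differentiable (by simp)) (I t)).hasFDerivAt.comp t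
          I.toContinuousLinearEquiv.hasFDerivAt
      simpa using h2.hasDerivAt
    rw [h1.deriv, enorm_le_iff_norm_le]
    exact ((fderiv ℝ φ (I t)).le_opNorm (I 1)).trans
      (mul_le_of_le_one_right (norm_nonneg _) ((I.norm_map (1 : ℝ)).trans norm_one).le)
  calc ‖φ x‖ₑ = ‖(φ ∘ I) (I.symm x)‖ₑ := by simp
    _ ≤ ∫⁻ t in Set.Iic (I.symm x), ‖deriv (φ ∘ I) t‖ₑ :=
      HasCompactSupport.enorm_le_lintegral_Ici_deriv hI hIc _
    _ ≤ ∫⁻ t, ‖deriv (φ ∘ I) t‖ₑ := setLIntegral_le_lintegral _ _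
    _ ≤ ∫⁻ t, ‖fderiv ℝ φ (I t)‖ₑ := lintegral_mono hderiv
    _ = ∫⁻ y, ‖fderiv ℝ φ y‖ₑ := I.measurePreserving.lintegral_comp
      (hφ.continuous_fderiv (by simp)).enorm.measurable
    _ = _ := eLpNorm_one_eq_lintegral_enorm.symm

/-- The Sobolev inequality on test functions, in the form needed for the exponent `2 q`. -/
theorem exists_eLpNorm_le_fderiv (hd : 1 ≤ d ∧ d ≤ 3) (hOb : Bornology.IsBounded O)
    {q : ℝ≥0} (hq : 1 ≤ q) (hq3 : d = 3 → q ≤ 3) :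
    ∃ C : ℝ≥0∞, C ≠ ⊤ ∧ ∀ φ : EuclideanSpace ℝ (Fin d) → ℝ, ContDiff ℝ 1 φ →
      HasCompactSupport φ → tsupport φ ⊆ O →
      eLpNorm φ ((2 * q : ℝ≥0) : ℝ≥0∞) (volume.restrict O)
        ≤ C * eLpNorm (fderiv ℝ φ) 2 (volume.restrict O) := by
  have hfin : (volume.restrict O) Set.univ ≠ ⊤ := by
    rw [Measure.restrict_apply_univ]; exact hOb.measure_lt_top.ne
  have key : ∀ p : ℝ≥0, 1 ≤ p → p ≤ 2 → p < (d : ℝ≥0) →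
      (p : ℝ)⁻¹ - (d : ℝ)⁻¹ ≤ ((2 * q : ℝ≥0) : ℝ)⁻¹ →
      ∃ C : ℝ≥0∞, C ≠ ⊤ ∧ ∀ φ : EuclideanSpace ℝ (Fin d) → ℝ, ContDiff ℝ 1 φ →
        HasCompactSupport φ → tsupport φ ⊆ O →
        eLpNorm φ ((2 * q : ℝ≥0) : ℝ≥0∞) (volume.restrict O)
          ≤ C * eLpNorm (fderiv ℝ φ) 2 (volume.restrict O) := by
    intro p hp1 hp2 hpd hpq
    have hp2' : (p : ℝ≥0∞) ≤ 2 := by exact_mod_cast hp2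
    refine ⟨eLpNormLESNormFDerivOfLeConst ℝ (volume : Measure (EuclideanSpace ℝ (Fin d))) O p
      (2 * q) * (volume.restrict O) Set.univ ^ (1 / (p : ℝ≥0∞).toReal - 1 / (2 : ℝ≥0∞).toReal),
      ENNReal.mul_ne_top ENNReal.coe_ne_top (ENNReal.rpow_ne_top_of_nonneg ?_ hfin),
      fun φ hφ hc hO => ?_⟩
    · rw [sub_nonneg, ENNReal.coe_toReal, ENNReal.toReal_ofNat]
      have : (1 : ℝ) ≤ p := by exact_mod_cast hp1
      exact one_div_le_one_div_of_le (by linarith) (by exact_mod_cast hp2)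
    · have hs : Function.support φ ⊆ O := (subset_tsupport _).trans hO
      have h1 := eLpNorm_le_eLpNorm_fderiv_of_le volume hφ hs hp1
        (by rwa [finrank_euclideanSpace_fin]) (q := 2 * q)
        (by rw [finrank_euclideanSpace_fin]; simpa using hpq) hOb
      rw [eLpNorm_restrict_eq_of_support_subset hs]
      refine h1.trans ?_
      rw [mul_assoc]
      gcongr
      rw [mul_comm]
      exact eLpNorm_fderiv_le hφ hO hp2'
  have hq' : (1 : ℝ) ≤ q := by exact_mod_cast hq
  obtain ⟨hd1, hd3⟩ := hd
  interval_cases d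
  · refine ⟨(volume.restrict O) Set.univ ^ (1 / (1 : ℝ≥0∞).toReal - 1 / (2 : ℝ≥0∞).toReal) *
      (volume.restrict O) Set.univ ^ ((2 * q : ℝ≥0) : ℝ≥0∞).toReal⁻¹,
      ENNReal.mul_ne_top (ENNReal.rpow_ne_top_of_nonneg (by norm_num) hfin)
        (ENNReal.rpow_ne_top_of_nonneg (by positivity) hfin), fun φ hφ hc hO => ?_⟩
    refine (eLpNorm_le_of_ae_enorm_bound
      (ae_of_all _ fun x => enorm_le_eLpNorm_fderiv_one hφ hc x)).trans ?_
    rw [smul_eq_mul, mul_right_comm]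
    gcongr
    rw [mul_comm]
    exact eLpNorm_fderiv_le hφ hO (by norm_num)
  -- For d = 2 this p has Sobolev conjugate exactly 2q, since 1/p - 1/2 = 1/(2q).
  · refine key (2 * q / (q + 1)) ?_ ?_ ?_ ?_
    · rw [one_le_div (by positivity)]
      linarith
    · rw [div_le_iff₀ (by positivity)]
      gcongr
      exact le_self_add
    · rw [div_lt_iff₀ (by positivity)]
      push_cast
      gcongr
      exact lt_add_one q
    · push_cast
      rw [inv_div]
      have : (0 : ℝ) < q := by linarith
      apply le_of_eq
      field_simp
      ring
  -- For d = 3 the conjugate of 2 is 6, so 2q ≤ 6 is where q ≤ 3 enters.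
  · have hq3' : (q : ℝ) ≤ 3 := by exact_mod_cast hq3 rfl
    refine key 2 (by norm_num) le_rfl (by norm_num) ?_
    push_cast
    rw [show (2 : ℝ)⁻¹ - 3⁻¹ = 6⁻¹ by norm_num]
    exact inv_anti₀ (by linarith) (by linarith)

/-- The Sobolev bound passes from test functions to the closure by Fatou along an almost everywhere
convergent subsequence. -/
theorem HasH10Grad.memLp (hd : 1 ≤ d ∧ d ≤ 3) (hOb : Bornology.IsBounded O)
    {q : ℝ≥0} (hq : 1 ≤ q) (hq3 : d = 3 → q ≤ 3) {u : L2 O} {p : L2Vec O}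
    (hu : HasH10Grad O u p) : MemLp u ((2 * q : ℝ≥0) : ℝ≥0∞) (volume.restrict O) := by
  obtain ⟨C, hC, hsob⟩ := exists_eLpNorm_le_fderiv hd hOb hq hq3
  refine ⟨(Lp.memLp u).1, ?_⟩
  obtain ⟨w, hw, hlim⟩ := mem_closure_iff_seq_limit.1 hu
  rw [Prod.tendsto_iff] at hlim
  obtain ⟨k, hk, hae⟩ := (tendstoInMeasure_of_tendsto_Lp hlim.1).exists_seq_tendsto_ae
  have hbound : ∀ n, eLpNorm (w n).1 ((2 * q : ℝ≥0) : ℝ≥0∞) (volume.restrict O)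
      ≤ C * ‖(w n).2‖ₑ := by
    intro n
    obtain ⟨φ, hφ, hc, hO, h1, h2⟩ := hw n
    rw [eLpNorm_congr_ae h1, Lp.enorm_def, eLpNorm_congr_ae h2,
      eLpNorm_congr_norm_ae (ae_of_all _ fun x => norm_gradient_eq x)]
    exact hsob φ (hφ.of_le (by simp)) hc hO
  have hconv : Tendsto (fun n => C * ‖(w (k n)).2‖ₑ) atTop (𝓝 (C * ‖p‖ₑ)) :=
    ENNReal.Tendsto.const_mul ((hlim.2.comp hk.tendsto_atTop).enorm) (Or.inr hC)
  calc eLpNorm u ((2 * q : ℝ≥0) : ℝ≥0∞) (volume.restrict O)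
      ≤ liminf (fun n => eLpNorm (w (k n)).1 ((2 * q : ℝ≥0) : ℝ≥0∞) (volume.restrict O)) atTop :=
        Lp.eLpNorm_lim_le_liminf_eLpNorm (fun n => (Lp.memLp (w (k n)).1).1) _ hae
    _ ≤ liminf (fun n => C * ‖(w (k n)).2‖ₑ) atTop :=
        liminf_le_liminf (Eventually.of_forall fun n => hbound (k n))
    _ = C * ‖p‖ₑ := hconv.liminf_eq
    _ < ⊤ := (ENNReal.mul_ne_top hC enorm_ne_top).lt_top

/-- Mean value inequality on [-|ξ|, |ξ|], with |ξ| ≤ 1 + |ξ|^q absorbing the linear term. -/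
theorem DriftCondition.exists_abs_le {f : ℝ → ℝ} {L₁ L₂ L₃ L₄ L₅ q : ℝ}
    (hf : DriftCondition f L₁ L₂ L₃ L₄ L₅ q) (hq : 1 ≤ q) :
    ∃ K : ℝ, ∀ ξ, |f ξ| ≤ K * (1 + |ξ| ^ q) := by
  refine ⟨|f 0| + |L₄| + |L₅|, fun ξ => ?_⟩
  have h := Convex.norm_image_sub_le_of_norm_deriv_le (f := f) (s := Set.Icc (-|ξ|) |ξ|)
    (x := 0) (y := ξ) (C := |L₄| * |ξ| ^ (q - 1) + |L₅|)
    (fun x _ => hf.differentiable x) (fun x hx => ?_) (convex_Icc _ _)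
    (by simp) (abs_le.1 le_rfl)
  · rw [Real.norm_eq_abs, Real.norm_eq_abs, sub_zero] at h
    have h1 : |ξ| ^ (q - 1) * |ξ| = |ξ| ^ q := by
      rcases eq_or_ne ξ 0 with rfl | h0
      · simp [Real.zero_rpow (by linarith : q ≠ 0)]
      · rw [← Real.rpow_add_one (abs_pos.2 h0).ne', sub_add_cancel]
    have h2 : |ξ| ≤ 1 + |ξ| ^ q := by
      rcases le_total |ξ| 1 with h0 | h0
      · have := Real.rpow_nonneg (abs_nonneg ξ) q
        linarith
      · have := Real.rpow_le_rpow_of_exponent_le h0 hq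
        rw [Real.rpow_one] at this
        linarith
    have h3 : |f ξ| ≤ |f 0| + |f ξ - f 0| := by
      have := abs_add_le (f 0) (f ξ - f 0)
      simpa using this
    have h4 : 0 ≤ |ξ| ^ q := Real.rpow_nonneg (abs_nonneg ξ) q
    have h5 : (|L₄| * |ξ| ^ (q - 1) + |L₅|) * |ξ| = |L₄| * |ξ| ^ q + |L₅| * |ξ| := by
      rw [← h1]; ring
    nlinarith [abs_nonneg (f 0), abs_nonneg L₄, abs_nonneg L₅,
      mul_le_mul_of_nonneg_left h2 (abs_nonneg L₅), mul_nonneg (abs_nonneg (f 0)) h4]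
  · rw [Real.norm_eq_abs]
    have hx' : |x| ≤ |ξ| := abs_le.2 hx
    calc |deriv f x| ≤ L₄ * |x| ^ (q - 1) + L₅ := hf.growth x
      _ ≤ |L₄| * |x| ^ (q - 1) + |L₅| := by
        gcongr <;> exact le_abs_self _
      _ ≤ |L₄| * |ξ| ^ (q - 1) + |L₅| := by gcongr

/-- The Nemytskii operator of the drift maps `H¹₀` into `L²`. -/
theorem HasH10Grad.memLp_drift (hd : 1 ≤ d ∧ d ≤ 3) (hOb : Bornology.IsBounded O)
    {f : ℝ → ℝ} {L₁ L₂ L₃ L₄ L₅ q : ℝ} (hq : 1 ≤ q) (hq3 : d = 3 → q ≤ 3)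
    (hf : DriftCondition f L₁ L₂ L₃ L₄ L₅ q) {u : L2 O} {p : L2Vec O}
    (hu : HasH10Grad O u p) : MemLp (fun ξ => f (u ξ)) 2 (volume.restrict O) := by
  have : IsFiniteMeasure ((volume : Measure (EuclideanSpace ℝ (Fin d))).restrict O) :=
    isFiniteMeasure_restrict.2 hOb.measure_lt_top.ne
  obtain ⟨K, hK⟩ := hf.exists_abs_le hq
  lift q to ℝ≥0 using by linarith
  have hq0 : (q : ℝ≥0∞) ≠ 0 := by
    rw [ENNReal.coe_ne_zero]
    rintro rfl
    norm_num at hq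
  have h1 := (hu.memLp hd hOb (by exact_mod_cast hq)
    (fun h => by exact_mod_cast hq3 h)).norm_rpow_div q
  have h2 : ((2 * q : ℝ≥0) : ℝ≥0∞) / q = 2 := by
    rw [ENNReal.coe_mul, ENNReal.mul_div_cancel_right hq0 ENNReal.coe_ne_top, ENNReal.coe_ofNat]
  rw [h2] at h1
  have h3 : MemLp (fun ξ => 1 + ‖u ξ‖ ^ (q : ℝ≥0∞).toReal) 2 (volume.restrict O) :=
    MemLp.add (f := fun _ => (1 : ℝ)) (memLp_const (1 : ℝ)) h1
  refine h3.of_le_mul (c := K)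
    (hf.differentiable.continuous.comp_aestronglyMeasurable (Lp.memLp u).1)
    (ae_of_all _ fun ξ => ?_)
  have hpos : 0 ≤ 1 + ‖u ξ‖ ^ (q : ℝ≥0∞).toReal := by positivity
  rw [Real.norm_of_nonneg hpos, ENNReal.coe_toReal, Real.norm_eq_abs, Real.norm_eq_abs]
  exact hK (u ξ)

end DIE

/-! ### Diffusion coefficients, Wiener increments and the Itô isometry -/

namespace DIE

variable {d : ℕ} {O : Set (EuclideanSpace ℝ (Fin d))}

namespace DiffusionCondition
variable {g : ℝ → ℝ} {e : HilbertBasis ℕ ℝ (L2 O)} {κ : ℕ → ℝ} {L₆ L₇ L₈ : ℝ}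

/-- Needed to make the Lipschitz hypothesis effective: the `tsum` of a non-summable family would be
0 and bound nothing. -/
theorem summable_sub (hg : DiffusionCondition g e κ L₆ L₇ L₈) (hκ : ∀ k, 0 < κ k) (x y : L2 O) :
    Summable fun k => κ k * ‖nemytskii g x (e k) - nemytskii g y (e k)‖ ^ 2 := by
  refine Summable.of_nonneg_of_le (fun k => mul_nonneg (hκ k).le (sq_nonneg _)) (fun k => ?_)
    (((hg.summable x).add (hg.summable y)).mul_left 2)
  have h := parallelogram_law_with_norm ℝ (nemytskii g x (e k)) (nemytskii g y (e k))
  have h2 : ‖nemytskii g x (e k) - nemytskii g y (e k)‖ ^ 2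
      ≤ 2 * (‖nemytskii g x (e k)‖ ^ 2 + ‖nemytskii g y (e k)‖ ^ 2) := by
    nlinarith [sq_nonneg ‖nemytskii g x (e k) + nemytskii g y (e k)‖]
  nlinarith [mul_le_mul_of_nonneg_left h2 (hκ k).le]

theorem sum_le (hg : DiffusionCondition g e κ L₆ L₇ L₈) (hκ : ∀ k, 0 < κ k) (x y : L2 O)
    (s : Finset ℕ) :
    ∑ k ∈ s, κ k * ‖nemytskii g x (e k) - nemytskii g y (e k)‖ ^ 2 ≤ L₆ * ‖x - y‖ ^ 2 :=
  ((hg.summable_sub hκ x y).sum_le_tsum s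
    (fun k _ => mul_nonneg (hκ k).le (sq_nonneg _))).trans (hg.lipschitz x y)

/-- A single term of the Hilbert–Schmidt sum, divided by κ k > 0. It yields measurability of the
noise coefficients and square integrability of their differences. -/
theorem norm_sub_le (hg : DiffusionCondition g e κ L₆ L₇ L₈) (hκ : ∀ k, 0 < κ k) (k : ℕ)
    (x y : L2 O) :
    ‖nemytskii g x (e k) - nemytskii g y (e k)‖ ≤ √(L₆ / κ k) * ‖x - y‖ := by
  have h := hg.sum_le hκ x y {k}
  rw [Finset.sum_singleton] at h
  have h6 := hg.nonneg₆
  have hk := hκ k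
  refine (sq_le_sq₀ (norm_nonneg _) (by positivity)).1 ?_
  rw [mul_pow, Real.sq_sqrt (by positivity), div_mul_eq_mul_div, le_div_iff₀ hk]
  linarith

theorem continuous_nemytskii (hg : DiffusionCondition g e κ L₆ L₇ L₈) (hκ : ∀ k, 0 < κ k)
    (k : ℕ) : Continuous fun x => nemytskii g x (e k) := by
  refine (LipschitzWith.of_dist_le_mul (K := Real.toNNReal √(L₆ / κ k)) fun x y => ?_).continuous
  rw [dist_eq_norm, dist_eq_norm, Real.coe_toNNReal _ (Real.sqrt_nonneg _)]
  exact hg.norm_sub_le hκ k x y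

end DiffusionCondition

section Wiener
variable {Ω : Type*} {mΩ : MeasurableSpace Ω} {P : Measure Ω}
  {𝓕 : Filtration ℝ≥0 mΩ} {Q : L2 O →L[ℝ] L2 O} {e : HilbertBasis ℕ ℝ (L2 O)} {κ : ℕ → ℝ}
  {W : ℝ≥0 → Ω → L2 O} {s t : ℝ≥0}

namespace IsQWiener

theorem stronglyMeasurable_sub (hW : IsQWiener P 𝓕 Q W) (s t : ℝ≥0) :
    StronglyMeasurable fun ω => W t ω - W s ω :=
  ((hW.adapted t).mono (𝓕.le t)).sub ((hW.adapted s).mono (𝓕.le s))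

/-- Used for Φ a coordinate, its square, or a product of two coordinates of the increment. -/
theorem indepFun (hW : IsQWiener P 𝓕 Q W) (hst : s ≤ t) {Φ : L2 O → ℝ} (hΦ : Continuous Φ)
    {Z : Ω → ℝ} (hZ : StronglyMeasurable[𝓕 s] Z) :
    IndepFun (fun ω => Φ (W t ω - W s ω)) Z P := by
  rw [IndepFun_iff_Indep]
  refine indep_of_indep_of_le_left (indep_of_indep_of_le_right (hW.indep s t hst)
    hZ.measurable.comap_le) ?_
  change MeasurableSpace.comap (Φ ∘ fun ω => W t ω - W s ω) _ ≤ _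
  rw [← MeasurableSpace.comap_comp]
  refine MeasurableSpace.comap_mono ?_
  borelize (L2 O)
  exact hΦ.measurable.comap_le

theorem aemeasurable_inner (hW : IsQWiener P 𝓕 Q W) (h : L2 O) :
    AEMeasurable (fun ω => (inner ℝ h (W t ω - W s ω) : ℝ)) P :=
  ((continuous_const.inner continuous_id).comp_stronglyMeasurable
    (hW.stronglyMeasurable_sub s t)).measurable.aemeasurable

theorem memLp_inner (hW : IsQWiener P 𝓕 Q W) (hst : s ≤ t) (h : L2 O) :
    MemLp (fun ω => (inner ℝ h (W t ω - W s ω) : ℝ)) 2 P := by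
  have h1 := memLp_id_gaussianReal (μ := 0)
    (v := Real.toNNReal (((t : ℝ) - (s : ℝ)) * inner ℝ h (Q h))) 2
  rw [← hW.gaussian s t hst h] at h1
  exact (memLp_map_measure_iff h1.1 (hW.aemeasurable_inner h)).1 h1

theorem integral_inner (hW : IsQWiener P 𝓕 Q W) (hst : s ≤ t) (h : L2 O) :
    ∫ ω, (inner ℝ h (W t ω - W s ω) : ℝ) ∂P = 0 := by
  have h1 := integral_map (hW.aemeasurable_inner (s := s) (t := t) h) (f := fun x : ℝ => x)
    continuous_id.aestronglyMeasurable
  rw [← h1, hW.gaussian s t hst h, integral_id_gaussianReal]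

theorem integral_inner_sq (hW : IsQWiener P 𝓕 Q W) (hst : s ≤ t) {h : L2 O}
    (hQ : 0 ≤ (inner ℝ h (Q h) : ℝ)) :
    ∫ ω, (inner ℝ h (W t ω - W s ω) : ℝ) ^ 2 ∂P = ((t : ℝ) - s) * inner ℝ h (Q h) := by
  have h1 := integral_map (hW.aemeasurable_inner (s := s) (t := t) h) (f := fun x : ℝ => x ^ 2)
    (continuous_pow 2).aestronglyMeasurable
  have hst' : (s : ℝ) ≤ t := by exact_mod_cast hst
  have h2 := variance_fun_id_gaussianReal (μ := 0)
    (v := Real.toNNReal (((t : ℝ) - (s : ℝ)) * inner ℝ h (Q h)))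
  rw [variance_of_integral_eq_zero (X := fun x : ℝ => x) aemeasurable_id (integral_id_gaussianReal)] at h2
  rw [← h1, hW.gaussian s t hst h, h2, Real.coe_toNNReal _ (mul_nonneg (by linarith) hQ)]

theorem integral_inner_basis_sq (hQ : IsCovariance Q e κ) (hW : IsQWiener P 𝓕 Q W)
    (hst : s ≤ t) (k : ℕ) :
    ∫ ω, (inner ℝ (e k) (W t ω - W s ω) : ℝ) ^ 2 ∂P = ((t : ℝ) - s) * κ k := by
  have h : (inner ℝ (e k) (Q (e k)) : ℝ) = κ k := by
    rw [hQ.eigen, real_inner_smul_right, real_inner_self_eq_norm_sq, e.orthonormal.norm_eq_one]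
    ring
  rw [hW.integral_inner_sq hst (by rw [h]; exact (hQ.pos k).le), h]

/-- Polarization: the variance in direction e j + e k is κ j + κ k, leaving no room for a
covariance. Only the scalar Gaussian marginals are used. -/
theorem integral_inner_basis_mul (hQ : IsCovariance Q e κ) (hW : IsQWiener P 𝓕 Q W)
    (hst : s ≤ t) {j k : ℕ} (hjk : j ≠ k) :
    ∫ ω, (inner ℝ (e j) (W t ω - W s ω) : ℝ) * inner ℝ (e k) (W t ω - W s ω) ∂P = 0 := by
  have hjk0 : (inner ℝ (e j) (e k) : ℝ) = 0 := e.orthonormal.inner_eq_zero hjk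
  have hkj0 : (inner ℝ (e k) (e j) : ℝ) = 0 := e.orthonormal.inner_eq_zero hjk.symm
  have h : (inner ℝ (e j + e k) (Q (e j + e k)) : ℝ) = κ j + κ k := by
    rw [map_add, hQ.eigen, hQ.eigen, inner_add_left, inner_add_right, inner_add_right]
    simp_rw [real_inner_smul_right]
    rw [real_inner_self_eq_norm_sq, real_inner_self_eq_norm_sq, e.orthonormal.norm_eq_one,
      e.orthonormal.norm_eq_one, hjk0, hkj0]
    ring
  have h1 := hW.integral_inner_sq hst (h := e j + e k)
    (by rw [h]; exact (add_pos (hQ.pos j) (hQ.pos k)).le)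
  have hj := hW.memLp_inner hst (e j)
  have hk := hW.memLp_inner hst (e k)
  have h2 : ∀ ω, (inner ℝ (e j + e k) (W t ω - W s ω) : ℝ) ^ 2
      = inner ℝ (e j) (W t ω - W s ω) ^ 2 + inner ℝ (e k) (W t ω - W s ω) ^ 2
        + 2 * (inner ℝ (e j) (W t ω - W s ω) * inner ℝ (e k) (W t ω - W s ω)) := by
    intro ω
    rw [inner_add_left]
    ring
  simp_rw [h2] at h1
  have hsq : Integrable (fun ω => (inner ℝ (e j) (W t ω - W s ω) : ℝ) ^ 2
      + inner ℝ (e k) (W t ω - W s ω) ^ 2) P := hj.integrable_sq.add hk.integrable_sq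
  have hprod : Integrable (fun ω => 2 * ((inner ℝ (e j) (W t ω - W s ω) : ℝ)
      * inner ℝ (e k) (W t ω - W s ω))) P := (hj.integrable_mul hk).const_mul 2
  rw [integral_add hsq hprod,
    integral_add hj.integrable_sq hk.integrable_sq, integral_const_mul, h,
    integral_inner_basis_sq hQ hW hst, integral_inner_basis_sq hQ hW hst] at h1
  linarith

end IsQWiener

/-- The partial sums of the series defining a stochastic increment `Φ (W t - W s)`. -/
noncomputable def noiseSum (e : HilbertBasis ℕ ℝ (L2 O)) (a : ℕ → Ω → L2 O) (D : Ω → L2 O)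
    (n : ℕ) (ω : Ω) : L2 O :=
  ∑ k ∈ Finset.range n, (inner ℝ (e k) (D ω) : ℝ) • a k ω

theorem noiseSum_succ (a : ℕ → Ω → L2 O) (D : Ω → L2 O) (n : ℕ) (ω : Ω) :
    noiseSum e a D (n + 1) ω = noiseSum e a D n ω + (inner ℝ (e n) (D ω) : ℝ) • a n ω :=
  Finset.sum_range_succ _ _

/-- A product of two L² variables is in general only L¹; independence of their squares restores L².
-/
theorem IsQWiener.memLp_inner_smul [IsProbabilityMeasure P] (hW : IsQWiener P 𝓕 Q W)
    (hst : s ≤ t) (h : L2 O) {a : Ω → L2 O} (ha : StronglyMeasurable[𝓕 s] a) (ha2 : MemLp a 2 P) :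
    MemLp (fun ω => (inner ℝ h (W t ω - W s ω) : ℝ) • a ω) 2 P := by
  have hm : AEStronglyMeasurable (fun ω => (inner ℝ h (W t ω - W s ω) : ℝ) • a ω) P :=
    (hW.memLp_inner hst h).1.smul ha2.1
  rw [memLp_two_iff_integrable_sq_norm hm]
  have hi := (hW.indepFun hst (Φ := fun x => (inner ℝ h x : ℝ) ^ 2) (by fun_prop)
    (Z := fun ω => ‖a ω‖ ^ 2) ((continuous_norm.pow 2).comp_stronglyMeasurable ha)).integrable_mul
    (hW.memLp_inner hst h).integrable_sq (ha2.integrable_norm_pow (by norm_num))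
  refine hi.congr (ae_of_all _ fun ω => ?_)
  simp [norm_smul, mul_pow]

theorem IsQWiener.memLp_noiseSum [IsProbabilityMeasure P] (hW : IsQWiener P 𝓕 Q W) (hst : s ≤ t)
    {a : ℕ → Ω → L2 O} (ha : ∀ k, StronglyMeasurable[𝓕 s] (a k)) (ha2 : ∀ k, MemLp (a k) 2 P)
    (n : ℕ) : MemLp (noiseSum e a (fun ω => W t ω - W s ω) n) 2 P :=
  memLp_finsetSum _ fun k _ => hW.memLp_inner_smul hst (e k) (ha k) (ha2 k)

/-- The Itô isometry for the partial sums, with an added `𝓕 s`-measurable term. -/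
theorem IsQWiener.integral_norm_add_noiseSum_sq [IsProbabilityMeasure P]
    (hQ : IsCovariance Q e κ) (hW : IsQWiener P 𝓕 Q W) (hst : s ≤ t)
    {a : ℕ → Ω → L2 O} (ha : ∀ k, StronglyMeasurable[𝓕 s] (a k)) (ha2 : ∀ k, MemLp (a k) 2 P)
    {X : Ω → L2 O} (hX : StronglyMeasurable[𝓕 s] X) (hX2 : MemLp X 2 P) (n : ℕ) :
    ∫ ω, ‖X ω + noiseSum e a (fun ω => W t ω - W s ω) n ω‖ ^ 2 ∂P
      = (∫ ω, ‖X ω‖ ^ 2 ∂P)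
        + ∑ k ∈ Finset.range n, ((t : ℝ) - s) * κ k * ∫ ω, ‖a k ω‖ ^ 2 ∂P := by
  induction n with
  | zero => simp [noiseSum]
  | succ n ih =>
    set S := noiseSum e a (fun ω => W t ω - W s ω) n with hS
    set β : ℕ → Ω → ℝ := fun k ω => inner ℝ (e k) (W t ω - W s ω) with hβ
    have hS2 : MemLp S 2 P := hW.memLp_noiseSum hst ha ha2 n
    have hβ2 : ∀ k, MemLp (β k) 2 P := fun k => hW.memLp_inner hst (e k)
    have hinner : ∀ {Y : Ω → L2 O}, MemLp Y 2 P →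
        Integrable (fun ω => (inner ℝ (Y ω) (a n ω) : ℝ)) P := fun hY =>
      (hY.norm.integrable_mul (ha2 n).norm).mono' (hY.1.inner (ha2 n).1)
        (ae_of_all _ fun ω => norm_inner_le_norm _ _)
    -- Both kinds of cross term vanish by independence from 𝓕 s: here the increment has mean zero,
    -- below distinct coordinates are uncorrelated.
    have hXa : Integrable (fun ω => β n ω * inner ℝ (X ω) (a n ω)) P ∧
        ∫ ω, β n ω * inner ℝ (X ω) (a n ω) ∂P = 0 := by
      have hi := hW.indepFun hst (Φ := fun x => (inner ℝ (e n) x : ℝ)) (by fun_prop)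
        (Z := fun ω => (inner ℝ (X ω) (a n ω) : ℝ)) (hX.inner (ha n))
      refine ⟨hi.integrable_mul ((hβ2 n).integrable (by norm_num)) (hinner hX2), ?_⟩
      have := hi.integral_fun_mul_eq_mul_integral (hβ2 n).1 (hinner hX2).1
      rw [hW.integral_inner hst, zero_mul] at this
      exact this
    have hka : ∀ k < n, Integrable (fun ω => β n ω * β k ω * inner ℝ (a k ω) (a n ω)) P ∧
        ∫ ω, β n ω * β k ω * inner ℝ (a k ω) (a n ω) ∂P = 0 := by
      intro k hk
      have hi := hW.indepFun hst
        (Φ := fun x => (inner ℝ (e n) x : ℝ) * inner ℝ (e k) x) (by fun_prop)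
        (Z := fun ω => (inner ℝ (a k ω) (a n ω) : ℝ)) ((ha k).inner (ha n))
      refine ⟨hi.integrable_mul ((hβ2 n).integrable_mul (hβ2 k)) (hinner (ha2 k)), ?_⟩
      have := hi.integral_fun_mul_eq_mul_integral ((hβ2 n).integrable_mul (hβ2 k)).1
        (hinner (ha2 k)).1
      rw [IsQWiener.integral_inner_basis_mul hQ hW hst hk.ne', zero_mul] at this
      exact this
    have hna : Integrable (fun ω => β n ω ^ 2 * ‖a n ω‖ ^ 2) P ∧
        ∫ ω, β n ω ^ 2 * ‖a n ω‖ ^ 2 ∂P = ((t : ℝ) - s) * κ n * ∫ ω, ‖a n ω‖ ^ 2 ∂P := by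
      have hi := hW.indepFun hst (Φ := fun x => (inner ℝ (e n) x : ℝ) ^ 2) (by fun_prop)
        (Z := fun ω => ‖a n ω‖ ^ 2) ((continuous_norm.pow 2).comp_stronglyMeasurable (ha n))
      have h2 := (ha2 n).integrable_norm_pow (by norm_num)
      refine ⟨hi.integrable_mul (hβ2 n).integrable_sq h2, ?_⟩
      have := hi.integral_fun_mul_eq_mul_integral (hβ2 n).integrable_sq.1 h2.1
      rw [IsQWiener.integral_inner_basis_sq hQ hW hst] at this
      exact this
    have hexp : ∀ ω, ‖X ω + noiseSum e a (fun ω => W t ω - W s ω) (n + 1) ω‖ ^ 2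
        = ‖X ω + S ω‖ ^ 2 + 2 * (β n ω * inner ℝ (X ω) (a n ω)
          + ∑ k ∈ Finset.range n, β n ω * β k ω * inner ℝ (a k ω) (a n ω))
          + β n ω ^ 2 * ‖a n ω‖ ^ 2 := by
      intro ω
      have hSa : (inner ℝ (S ω) (a n ω) : ℝ)
          = ∑ k ∈ Finset.range n, β k ω * inner ℝ (a k ω) (a n ω) := by
        rw [hS, noiseSum, sum_inner]
        simp_rw [real_inner_smul_left]
        rfl
      rw [noiseSum_succ, ← add_assoc, norm_add_sq_real, real_inner_smul_right, inner_add_left,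
        hSa, norm_smul, mul_pow, Real.norm_eq_abs, sq_abs, mul_add, Finset.mul_sum]
      simp_rw [mul_assoc]
      rfl
    simp_rw [hexp]
    have hsum : Integrable (fun ω => ∑ k ∈ Finset.range n,
        β n ω * β k ω * inner ℝ (a k ω) (a n ω)) P :=
      integrable_finsetSum _ fun k hk => (hka k (Finset.mem_range.1 hk)).1
    have h2 : Integrable (fun ω => ‖X ω + S ω‖ ^ 2) P :=
      (hX2.add hS2).integrable_norm_pow (by norm_num)
    have h3 : Integrable (fun ω => 2 * (β n ω * inner ℝ (X ω) (a n ω)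
        + ∑ k ∈ Finset.range n, β n ω * β k ω * inner ℝ (a k ω) (a n ω))) P :=
      (hXa.1.add hsum).const_mul 2
    have h4 : Integrable (fun ω => ‖X ω + S ω‖ ^ 2 + 2 * (β n ω * inner ℝ (X ω) (a n ω)
        + ∑ k ∈ Finset.range n, β n ω * β k ω * inner ℝ (a k ω) (a n ω))) P := h2.add h3
    rw [integral_add h4 hna.1, integral_add h2 h3, integral_const_mul,
      integral_add hXa.1 hsum, hXa.2, hna.2,
      integral_finsetSum _ fun k hk => (hka k (Finset.mem_range.1 hk)).1,
      Finset.sum_eq_zero fun k hk => (hka k (Finset.mem_range.1 hk)).2, ih,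
      Finset.sum_range_succ]
    ring

end Wiener

end DIE

/-! ### Mean square contraction and the Feller property -/

namespace DIE

variable {d : ℕ} {O : Set (EuclideanSpace ℝ (Fin d))}

theorem eLpNorm_two_eq_sqrt_integral {α E : Type*} [MeasurableSpace α] {μ : Measure α}
    [NormedAddCommGroup E] {f : α → E} (hf : MemLp f 2 μ) :
    eLpNorm f 2 μ = ENNReal.ofReal √(∫ x, ‖f x‖ ^ 2 ∂μ) := by
  rw [hf.eLpNorm_eq_integral_rpow_norm two_ne_zero ENNReal.ofNat_ne_top, Real.sqrt_eq_rpow]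
  norm_num

theorem integral_norm_sq_le_iff {α E : Type*} [MeasurableSpace α] {μ : Measure α}
    [NormedAddCommGroup E] {f : α → E} (hf : MemLp f 2 μ) {B : ℝ} (hB : 0 ≤ B) :
    ∫ x, ‖f x‖ ^ 2 ∂μ ≤ B ↔ eLpNorm f 2 μ ≤ ENNReal.ofReal √B := by
  rw [eLpNorm_two_eq_sqrt_integral hf, ENNReal.ofReal_le_ofReal_iff (Real.sqrt_nonneg _),
    Real.sqrt_le_sqrt_iff hB]

section Noise
variable {Ω : Type*} {mΩ : MeasurableSpace Ω} {P : Measure Ω} [IsProbabilityMeasure P]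
  {𝓕 : Filtration ℝ≥0 mΩ} {Q : L2 O →L[ℝ] L2 O} {e : HilbertBasis ℕ ℝ (L2 O)} {κ : ℕ → ℝ}
  {W : ℝ≥0 → Ω → L2 O} {s t : ℝ≥0} {g : ℝ → ℝ} {L₆ L₇ L₈ : ℝ}

/-- The mean square of `X - Y` plus the difference of the noise increments. -/
theorem integral_norm_add_noise_sq_le (hQ : IsCovariance Q e κ) (hW : IsQWiener P 𝓕 Q W)
    (hg : DiffusionCondition g e κ L₆ L₇ L₈) (hst : s ≤ t) {X Y N M : Ω → L2 O}
    (hX : StronglyMeasurable[𝓕 s] X) (hY : StronglyMeasurable[𝓕 s] Y)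
    (hXY : MemLp (fun ω => X ω - Y ω) 2 P)
    (hN : IsNoiseTerm P e (fun k ω => nemytskii g (X ω) (e k)) (fun ω => W t ω - W s ω) N)
    (hM : IsNoiseTerm P e (fun k ω => nemytskii g (Y ω) (e k)) (fun ω => W t ω - W s ω) M) :
    MemLp (fun ω => (X ω - Y ω) + (N ω - M ω)) 2 P ∧
      ∫ ω, ‖(X ω - Y ω) + (N ω - M ω)‖ ^ 2 ∂P
        ≤ (1 + ((t : ℝ) - s) * L₆) * ∫ ω, ‖X ω - Y ω‖ ^ 2 ∂P := by
  have hts : 0 ≤ (t : ℝ) - s := sub_nonneg.2 (by exact_mod_cast hst)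
  set D : Ω → L2 O := fun ω => W t ω - W s ω with hD
  set aX : ℕ → Ω → L2 O := fun k ω => nemytskii g (X ω) (e k) with haX
  set aY : ℕ → Ω → L2 O := fun k ω => nemytskii g (Y ω) (e k) with haY
  have hmX : ∀ k, StronglyMeasurable[𝓕 s] (aX k) := fun k =>
    (hg.continuous_nemytskii hQ.pos k).comp_stronglyMeasurable hX
  have hmY : ∀ k, StronglyMeasurable[𝓕 s] (aY k) := fun k =>
    (hg.continuous_nemytskii hQ.pos k).comp_stronglyMeasurable hY
  set a : ℕ → Ω → L2 O := fun k ω => aX k ω - aY k ω with ha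
  have hma : ∀ k, StronglyMeasurable[𝓕 s] (a k) := fun k => (hmX k).sub (hmY k)
  -- Only the difference X - Y has to be square integrable; no moments of X or Y separately are
  -- used.
  have ha2 : ∀ k, MemLp (a k) 2 P := fun k =>
    hXY.of_le_mul ((hma k).mono (𝓕.le s)).aestronglyMeasurable
      (ae_of_all _ fun ω => hg.norm_sub_le hQ.pos k (X ω) (Y ω))
  have hXYm : StronglyMeasurable[𝓕 s] fun ω => X ω - Y ω := hX.sub hY
  set S := noiseSum e a D with hS
  have hS2 : ∀ n, MemLp (S n) 2 P := fun n => hW.memLp_noiseSum hst hma ha2 n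
  have hSm : ∀ {b : ℕ → Ω → L2 O}, (∀ k, StronglyMeasurable[𝓕 s] (b k)) →
      ∀ n, AEStronglyMeasurable (noiseSum e b D n) P := by
    intro b hb n
    refine (Finset.stronglyMeasurable_fun_sum _ fun k _ => ?_).aestronglyMeasurable
    exact (((continuous_const (y := e k)).inner (𝕜 := ℝ) continuous_id).comp_stronglyMeasurable
      (hW.stronglyMeasurable_sub s t)).smul ((hb k).mono (𝓕.le s))
  have hconv : Tendsto (fun n => eLpNorm (fun ω => (N ω - M ω) - S n ω) 2 P) atTop (𝓝 0) := by
    have hsum := hN.2.add hM.2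
    rw [add_zero] at hsum
    refine tendsto_of_tendsto_of_tendsto_of_le_of_le tendsto_const_nhds hsum
      (fun n => zero_le) (fun n => ?_)
    have heq : (fun ω => (N ω - M ω) - S n ω) = (fun ω => N ω - noiseSum e aX D n ω)
        - fun ω => M ω - noiseSum e aY D n ω := by
      funext ω
      simp only [hS, noiseSum, ha, smul_sub, Finset.sum_sub_distrib, Pi.sub_apply]
      abel
    rw [heq]
    exact eLpNorm_sub_le (hN.1.sub (hSm hmX n)) (hM.1.sub (hSm hmY n)) (by norm_num)
  -- One partial sum at finite L² distance is enough.
  have hNM : MemLp (fun ω => N ω - M ω) 2 P := by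
    obtain ⟨n, hn⟩ := (hconv.eventually (gt_mem_nhds (zero_lt_one' ℝ≥0∞))).exists
    have h1 : MemLp (fun ω => (N ω - M ω) - S n ω) 2 P :=
      ⟨(hN.1.sub hM.1).sub (hS2 n).1, hn.trans ENNReal.one_lt_top⟩
    refine (h1.add (hS2 n)).congr_norm (hN.1.sub hM.1) (ae_of_all _ fun ω => ?_)
    simp
  have hres : MemLp (fun ω => (X ω - Y ω) + (N ω - M ω)) 2 P := hXY.add hNM
  refine ⟨hres, ?_⟩
  have hI : 0 ≤ ∫ ω, ‖X ω - Y ω‖ ^ 2 ∂P := integral_nonneg fun ω => by positivity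
  have h6 := hg.nonneg₆
  set B := (1 + ((t : ℝ) - s) * L₆) * ∫ ω, ‖X ω - Y ω‖ ^ 2 ∂P with hB
  have hB0 : 0 ≤ B := by positivity
  have hpart : ∀ n, eLpNorm (fun ω => (X ω - Y ω) + S n ω) 2 P ≤ ENNReal.ofReal √B := by
    intro n
    have hadd : MemLp (fun ω => (X ω - Y ω) + S n ω) 2 P := hXY.add (hS2 n)
    rw [← integral_norm_sq_le_iff hadd hB0,
      hW.integral_norm_add_noiseSum_sq hQ hst hma ha2 hXYm hXY n, hB, add_mul, one_mul]
    gcongr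
    simp_rw [mul_assoc]
    rw [← Finset.mul_sum]
    gcongr
    have hi : ∀ k, Integrable (fun ω => κ k * ‖a k ω‖ ^ 2) P := fun k =>
      ((ha2 k).integrable_norm_pow (by norm_num)).const_mul _
    simp_rw [← integral_const_mul]
    rw [← integral_finsetSum _ fun k _ => hi k]
    exact integral_mono (integrable_finsetSum _ fun k _ => hi k)
      ((hXY.integrable_norm_pow (by norm_num)).const_mul _)
      fun ω => hg.sum_le hQ.pos (X ω) (Y ω) _
  -- The bound is uniform in n, so the triangle inequality carries it to the limit of the series.
  rw [integral_norm_sq_le_iff hres hB0]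
  have hlim : Tendsto (fun n => ENNReal.ofReal √B
      + eLpNorm (fun ω => (N ω - M ω) - S n ω) 2 P) atTop (𝓝 (ENNReal.ofReal √B + 0)) :=
    tendsto_const_nhds.add hconv
  rw [add_zero] at hlim
  refine ge_of_tendsto' hlim fun n => ?_
  have heq : (fun ω => (X ω - Y ω) + (N ω - M ω)) = (fun ω => (X ω - Y ω) + S n ω)
      + fun ω => (N ω - M ω) - S n ω := by
    funext ω
    simp only [Pi.add_apply]
    abel
  rw [heq]
  exact (eLpNorm_add_le (hXY.add (hS2 n)).1 (hNM.sub (hS2 n)).1 (by norm_num)).trans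
    (add_le_add_left (hpart n) _)

end Noise

/-- One implicit step is a contraction up to the factor `1 + 2 τ (λ₁ - L₁)`. -/
theorem IsImplicitStep.norm_sub_sq_le (hd : 1 ≤ d ∧ d ≤ 3) (hOb : Bornology.IsBounded O)
    (e : HilbertBasis ℕ ℝ (L2 O))
    {f : ℝ → ℝ} {L₁ L₂ L₃ L₄ L₅ q : ℝ} (hq : 1 ≤ q) (hq3 : d = 3 → q ≤ 3)
    (hf : DriftCondition f L₁ L₂ L₃ L₄ L₅ q) {τ : ℝ} (hτ : 0 ≤ τ) {x y n n' u v : L2 O}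
    (hu : IsImplicitStep O f τ x n u) (hv : IsImplicitStep O f τ y n' v) :
    (1 + τ * (2 * (firstEigenvalue O - L₁))) * ‖u - v‖ ^ 2 ≤ ‖(x - y) + (n - n')‖ ^ 2 := by
  have : IsFiniteMeasure ((volume : Measure (EuclideanSpace ℝ (Fin d))).restrict O) :=
    isFiniteMeasure_restrict.2 hOb.measure_lt_top.ne
  obtain ⟨p, hp, hu⟩ := hu
  obtain ⟨r, hr, hv⟩ := hv
  have hw := hp.sub hr
  have h1 := hu _ _ hw
  have h2 := hv _ _ hw
  have h3 := firstEigenvalue_mul_norm_sq_le e hw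
  have hfu := hp.memLp_drift hd hOb hq hq3 hf
  have hfv := hr.memLp_drift hd hOb hq hq3 hf
  have hw2 := Lp.memLp (u - v)
  have hiu : Integrable (fun ξ => f (u ξ) * (u - v) ξ) (volume.restrict O) := hfu.integrable_mul hw2
  have hiv : Integrable (fun ξ => f (v ξ) * (u - v) ξ) (volume.restrict O) := hfv.integrable_mul hw2
  have h4 : (∫ ξ in O, f (u ξ) * (u - v) ξ) - (∫ ξ in O, f (v ξ) * (u - v) ξ)
      ≤ L₁ * ‖u - v‖ ^ 2 := by
    rw [← integral_sub hiu hiv, Lp_two_norm_sq, ← integral_const_mul]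
    refine integral_mono_ae (hiu.sub hiv)
      ((hw2.integrable_norm_pow (by norm_num)).const_mul _) ?_
    filter_upwards [Lp.coeFn_sub u v] with ξ hξ
    rw [hξ, Pi.sub_apply, ← sub_mul, Real.norm_eq_abs, sq_abs]
    exact hf.monotone _ _
  set w := u - v with hwdef
  -- Young's inequality; half of ‖w‖² is absorbed on the left, and doubling explains the factor 2 in
  -- b.
  have h5 : (inner ℝ ((x - y) + (n - n')) w : ℝ) ≤ (‖(x - y) + (n - n')‖ ^ 2 + ‖w‖ ^ 2) / 2 := by
    nlinarith [real_inner_le_norm ((x - y) + (n - n')) w,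
      sq_nonneg (‖(x - y) + (n - n')‖ - ‖w‖)]
  have h6 : ‖w‖ ^ 2 = (inner ℝ u w : ℝ) - inner ℝ v w := by
    rw [← inner_sub_left, ← hwdef, real_inner_self_eq_norm_sq]
  have h7 : (inner ℝ ((x - y) + (n - n')) w : ℝ)
      = inner ℝ x w - inner ℝ y w + (inner ℝ n w - inner ℝ n' w) := by
    rw [inner_add_left, inner_sub_left, inner_sub_left]
  have h8 : ‖p - r‖ ^ 2 = (inner ℝ p (p - r) : ℝ) - inner ℝ r (p - r) := by
    rw [← inner_sub_left, real_inner_self_eq_norm_sq]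
  have h9 := mul_le_mul_of_nonneg_left h3 hτ
  have h10 := mul_le_mul_of_nonneg_left h4 hτ
  rw [h8] at h9
  linarith

/-- Replacing 1 + τb by 1 + b, which τ ≤ 1 permits, makes the rate independent of τ; then 1 - s ≤
exp(-s). -/
theorem one_add_div_le_exp {τ b c : ℝ} (hτ0 : 0 ≤ τ) (hτ1 : τ ≤ 1) (hc : 0 ≤ c) (hcb : c < b) :
    (1 + τ * c) / (1 + τ * b) ≤ Real.exp (-((b - c) / (1 + b)) * τ) := by
  have hb : 0 < b := hc.trans_lt hcb
  have h1 : (1 + τ * c) / (1 + τ * b) ≤ 1 - (b - c) / (1 + b) * τ := by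
    have h2 : (1 + τ * c) / (1 + τ * b) = 1 - (b - c) / (1 + τ * b) * τ := by
      have : 1 + τ * b ≠ 0 := by positivity
      field_simp
      ring
    rw [h2]
    gcongr
    exact mul_le_of_le_one_left hb.le hτ1
  refine h1.trans ?_
  have := Real.add_one_le_exp (-((b - c) / (1 + b)) * τ)
  linarith

section Semigroup
variable {H Ω : Type*} [NormedAddCommGroup H] {mΩ : MeasurableSpace Ω} {P : Measure Ω}
  [IsProbabilityMeasure P]

/-- Mean square Lipschitz dependence on the starting point implies the Feller property. -/
theorem exists_semigroup_eq (X : H → ℕ → Ω → H) (m : ℕ)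
    (hX : ∀ x, AEStronglyMeasurable (X x m) P) {C : ℝ}
    (hC : ∀ x y, MemLp (fun ω => X x m ω - X y m ω) 2 P ∧
      ∫ ω, ‖X x m ω - X y m ω‖ ^ 2 ∂P ≤ C * ‖x - y‖ ^ 2) (φ : H →ᵇ ℝ) :
    ∃ ψ : H →ᵇ ℝ, ∀ x, ψ x = semigroup P X m φ x := by
  have hcont : Continuous (semigroup P X m φ) := by
    rw [continuous_iff_seqContinuous]
    intro xs x hxs
    -- Every subsequence has a further one along which the processes converge almost surely, where
    -- dominated convergence applies with bound ‖φ‖.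
    refine tendsto_of_subseq_tendsto fun ns hns => ?_
    have hdist : Tendsto (fun n => C * ‖xs (ns n) - x‖ ^ 2) atTop (𝓝 0) := by
      have h1 := tendsto_iff_norm_sub_tendsto_zero.1 (hxs.comp hns)
      simpa using (h1.pow 2).const_mul C
    have hL2 : Tendsto (fun n => eLpNorm (X (xs (ns n)) m - X x m) 2 P) atTop (𝓝 0) := by
      have h2 : Tendsto (fun n => ENNReal.ofReal √(C * ‖xs (ns n) - x‖ ^ 2)) atTop (𝓝 0) := by
        simpa using ENNReal.tendsto_ofReal hdist.sqrt
      refine tendsto_of_tendsto_of_tendsto_of_le_of_le tendsto_const_nhds h2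
        (fun n => zero_le) (fun n => ?_)
      refine (eLpNorm_two_eq_sqrt_integral (hC (xs (ns n)) x).1).le.trans ?_
      exact ENNReal.ofReal_le_ofReal (Real.sqrt_le_sqrt (hC (xs (ns n)) x).2)
    obtain ⟨ms, -, hae⟩ := (tendstoInMeasure_of_tendsto_eLpNorm (p := 2) two_ne_zero
      (fun n => hX (xs (ns n))) (hX x) hL2).exists_seq_tendsto_ae
    refine ⟨ms, tendsto_integral_of_dominated_convergence (fun _ => ‖φ‖)
      (fun n => φ.continuous.comp_aestronglyMeasurable (hX _)) (integrable_const _)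
      (fun n => ae_of_all _ fun ω => φ.norm_coe_le_norm _) ?_⟩
    filter_upwards [hae] with ω hω
    exact (φ.continuous.tendsto _).comp hω
  refine ⟨BoundedContinuousFunction.ofNormedAddCommGroup _ hcont ‖φ‖ fun x => ?_, fun x => rfl⟩
  refine (norm_integral_le_of_norm_le_const (ae_of_all P fun ω =>
    φ.norm_coe_le_norm (X x m ω))).trans ?_
  simp

end Semigroup

/-- Mean square contraction of the drift-implicit Euler scheme. -/
theorem IsSolution.memLp_sub_and_integral_le (hd : 1 ≤ d ∧ d ≤ 3) (hOb : Bornology.IsBounded O)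
    {Ω : Type*} {mΩ : MeasurableSpace Ω} {P : Measure Ω} [IsProbabilityMeasure P]
    {𝓕 : Filtration ℝ≥0 mΩ} {Q : L2 O →L[ℝ] L2 O} {e : HilbertBasis ℕ ℝ (L2 O)} {κ : ℕ → ℝ}
    (hQ : IsCovariance Q e κ) {W : ℝ≥0 → Ω → L2 O} (hW : IsQWiener P 𝓕 Q W)
    {f g : ℝ → ℝ} {L₁ L₂ L₃ L₄ L₅ L₆ L₇ L₈ q : ℝ} (hq : 1 ≤ q) (hq3 : d = 3 → q ≤ 3)
    (hf : DriftCondition f L₁ L₂ L₃ L₄ L₅ q) (hg : DiffusionCondition g e κ L₆ L₇ L₈)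
    {b : ℝ} (hb : b = 2 * (firstEigenvalue O - L₁)) (hL : L₆ < b)
    {τ : ℝ≥0} (hτ : τ < 1) {x y : L2 O} {X Y : ℕ → Ω → L2 O}
    (hX : IsSolution P 𝓕 e W f g τ x X) (hY : IsSolution P 𝓕 e W f g τ y Y) (m : ℕ) :
    MemLp (fun ω => X m ω - Y m ω) 2 P ∧ ∫ ω, ‖X m ω - Y m ω‖ ^ 2 ∂P
      ≤ Real.exp (-((b - L₆) / (1 + b)) * (m * τ)) * ‖x - y‖ ^ 2 := by
  have hb0 : 0 < b := hg.nonneg₆.trans_lt hL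
  induction m with
  | zero =>
    have h0 : (fun ω => X 0 ω - Y 0 ω) =ᵐ[P] fun _ => x - y := by
      filter_upwards [hX.init, hY.init] with ω h1 h2
      rw [h1, h2]
    refine ⟨(memLp_congr_ae h0).2 (memLp_const _), ?_⟩
    have h1 : (fun ω => ‖X 0 ω - Y 0 ω‖ ^ 2) =ᵐ[P] fun _ => ‖x - y‖ ^ 2 := by
      filter_upwards [h0] with ω hω
      rw [hω]
    rw [integral_congr_ae h1]
    simp
  | succ m ih =>
    obtain ⟨N, hN, hNs⟩ := hX.step m
    obtain ⟨M, hM, hMs⟩ := hY.step m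
    have hst : (m : ℝ≥0) * τ ≤ ((m + 1 : ℕ) : ℝ≥0) * τ := by
      gcongr
      exact m.le_succ
    obtain ⟨hmem, hnoise⟩ := integral_norm_add_noise_sq_le hQ hW hg hst (hX.adapted m)
      (hY.adapted m) ih.1 hN hM
    have hdiff : ((((m + 1 : ℕ) : ℝ≥0) * τ : ℝ≥0) : ℝ) - (((m : ℝ≥0) * τ : ℝ≥0) : ℝ) = τ := by
      push_cast
      ring
    rw [hdiff] at hnoise
    have hc : 0 < 1 + (τ : ℝ) * b := by positivity
    have hstep : ∀ᵐ ω ∂P, (1 + (τ : ℝ) * b) * ‖X (m + 1) ω - Y (m + 1) ω‖ ^ 2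
        ≤ ‖(X m ω - Y m ω) + (N ω - M ω)‖ ^ 2 := by
      filter_upwards [hNs, hMs] with ω h1 h2
      rw [hb]
      exact h1.norm_sub_sq_le hd hOb e hq hq3 hf τ.2 h2
    have hmeas : AEStronglyMeasurable (fun ω => X (m + 1) ω - Y (m + 1) ω) P :=
      (((hX.adapted (m + 1)).mono (𝓕.le _)).sub
        ((hY.adapted (m + 1)).mono (𝓕.le _))).aestronglyMeasurable
    -- Square integrability propagates because 1 + τb ≥ 1; the induction starts from the constant x
    -- - y.
    have hmem' : MemLp (fun ω => X (m + 1) ω - Y (m + 1) ω) 2 P := by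
      refine hmem.mono hmeas ?_
      filter_upwards [hstep] with ω hω
      refine (sq_le_sq₀ (norm_nonneg _) (norm_nonneg _)).1 (le_trans ?_ hω)
      exact le_mul_of_one_le_left (by positivity) (le_add_of_nonneg_right (by positivity))
    refine ⟨hmem', ?_⟩
    have hint : (1 + (τ : ℝ) * b) * ∫ ω, ‖X (m + 1) ω - Y (m + 1) ω‖ ^ 2 ∂P
        ≤ ∫ ω, ‖(X m ω - Y m ω) + (N ω - M ω)‖ ^ 2 ∂P := by
      rw [← integral_const_mul]
      exact integral_mono_ae ((hmem'.integrable_norm_pow (by norm_num)).const_mul _)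
        (hmem.integrable_norm_pow (by norm_num)) hstep
    have hI : 0 ≤ ∫ ω, ‖X m ω - Y m ω‖ ^ 2 ∂P := integral_nonneg fun ω => by positivity
    calc ∫ ω, ‖X (m + 1) ω - Y (m + 1) ω‖ ^ 2 ∂P
        ≤ (1 + (τ : ℝ) * L₆) / (1 + (τ : ℝ) * b) * ∫ ω, ‖X m ω - Y m ω‖ ^ 2 ∂P := by
          rw [div_mul_eq_mul_div, le_div_iff₀ hc, mul_comm]
          exact hint.trans hnoise
      _ ≤ Real.exp (-((b - L₆) / (1 + b)) * τ)
          * (Real.exp (-((b - L₆) / (1 + b)) * (m * τ)) * ‖x - y‖ ^ 2) := by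
          gcongr
          · exact one_add_div_le_exp τ.2 (by exact_mod_cast hτ.le) hg.nonneg₆ hL
          · exact ih.2
      _ = _ := by
          rw [← mul_assoc, ← Real.exp_add]
          push_cast
          ring_nf

end DIE

theorem lemma3p2 {d : ℕ} (hd : 1 ≤ d ∧ d ≤ 3)
    (O : Set (EuclideanSpace ℝ (Fin d))) (hO : IsOpen O) (hOb : Bornology.IsBounded O)
    (hOne : O.Nonempty)
    {Ω : Type*} [mΩ : MeasurableSpace Ω] (P : Measure Ω) [IsProbabilityMeasure P]
    (𝓕 : Filtration ℝ≥0 mΩ)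
    (Q : DIE.L2 O →L[ℝ] DIE.L2 O) (e : HilbertBasis ℕ ℝ (DIE.L2 O)) (κ : ℕ → ℝ)
    (hQ : DIE.IsCovariance Q e κ)
    (W : ℝ≥0 → Ω → DIE.L2 O) (hW : DIE.IsQWiener P 𝓕 Q W)
    (f g : ℝ → ℝ) (L₁ L₂ L₃ L₄ L₅ L₆ L₇ L₈ q : ℝ)
    (hq : 1 ≤ q) (hq3 : d = 3 → q ≤ 3)
    (hf : DIE.DriftCondition f L₁ L₂ L₃ L₄ L₅ q)
    (hg : DIE.DiffusionCondition g e κ L₆ L₇ L₈)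
    (hL : L₁ + L₆ / 2 < DIE.firstEigenvalue O) :
    ∃ γ : ℝ, 0 < γ ∧ ∀ τ : ℝ≥0, 0 < τ → τ < 1 →
      (∀ (x y : DIE.L2 O) (X Y : ℕ → Ω → DIE.L2 O),
        DIE.IsSolution P 𝓕 e W f g τ x X → DIE.IsSolution P 𝓕 e W f g τ y Y →
        ∀ m : ℕ, Integrable (fun ω => ‖X m ω - Y m ω‖ ^ 2) P ∧
          ∫ ω, ‖X m ω - Y m ω‖ ^ 2 ∂P ≤ Real.exp (-γ * (m * τ)) * ‖x - y‖ ^ 2) ∧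
      (∀ X : DIE.L2 O → ℕ → Ω → DIE.L2 O,
        (∀ x, DIE.IsSolution P 𝓕 e W f g τ x (X x)) →
        ∀ (φ : DIE.L2 O →ᵇ ℝ) (m : ℕ),
          ∃ ψ : DIE.L2 O →ᵇ ℝ, ∀ x, ψ x = DIE.semigroup P X m φ x) := by
  have h6 := hg.nonneg₆
  have hLb : L₆ < 2 * (DIE.firstEigenvalue O - L₁) := by linarith
  refine ⟨(2 * (DIE.firstEigenvalue O - L₁) - L₆) / (1 + 2 * (DIE.firstEigenvalue O - L₁)),
    div_pos (by linarith) (by linarith), fun τ _ hτ => ⟨fun x y X Y hX hY m => ?_,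
    fun X hX φ m => ?_⟩⟩
  · obtain ⟨h1, h2⟩ := DIE.IsSolution.memLp_sub_and_integral_le hd hOb hQ hW hq hq3 hf hg rfl hLb
      hτ hX hY m
    exact ⟨h1.integrable_norm_pow (by norm_num), h2⟩
  · exact DIE.exists_semigroup_eq X m
      (fun x => (((hX x).adapted m).mono (𝓕.le _)).aestronglyMeasurable)
      (fun x y => DIE.IsSolution.memLp_sub_and_integral_le hd hOb hQ hW hq hq3 hf hg rfl hLb
        hτ (hX x) (hX y) m) φ
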